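/- Let $d\ge 3$, and let $\mathfrak e:(\mathbb R/2\pi\mathbb Z)^d\to\mathbb R$ be a $C^3$ function such that both $\mathfrak e$ and $|\nabla\mathfrak e|^2=\sum_k(\partial_{p_k}\mathfrak e)^2$ are Morse functions (that is, $C^2$ with non-degenerate Hessian at every critical point). Notation. $\mathcal F:L^2((\mathbb R/2\pi\mathbb Z)^d,\frac{d^dp}{(2\pi)^d})\to\ell^2(\mathbb Z^d)$ is the Fourier transform $(\mathcal F\psi)(x)=\int e^{i\langle p,x\rangle}\psi(p)\frac{d^dp}{(2\pi)^d}$, and $\delta_x$, $x\in\mathbb Z^d$, is the canonical basis of $\ell^2(\mathbb Z^d)$. For bounded $V:\mathbb Z^d\to\mathbb R$ put $H(\mathfrak e,V)=\mathcal F\,\mathfrak e\,\mathcal F^{*}+V$, where $\mathfrak e$ and $V$ act as multiplication operators. With $|x|$ the Euclidean norm, put $$\Phi_{m,n}(V)=\Big(\sum_{x\in\mathbb Z^d}|V(x)|^{1/m}(|x|+1)^n\Big)^m\in[0,\infty].$$ Let $A=\mathcal F\hat A\mathcal F^*$ on the domain $\mathcal F(C^\infty((\mathbb R/2\pi\mathbb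 Z)^d))$, where $\hat A\psi=i\sum_{k=1}^d\big\{(\partial_{p_k}\mathfrak e)(\partial_{p_k}\psi)+\frac12(\partial_{p_k}^2\mathfrak e)\psi\big\}$. The commutator $i[H,A]$ with $H=H(\mathfrak e,V)$ is understood as the form $i(\langle H\varphi,A\psi\rangle-\langle A\varphi,H\psi\rangle)$ on the domain of $A$; if this form extends to a bounded operator, the operator is also denoted by $i[H,A]$. Then there is a constant $c\in(0,\infty)$, depending only on $d$ and $\mathfrak e$, such that for every bounded $V:\mathbb Z^d\to\mathbb R$ the following holds. (i) If $c\,\Phi_{2,2}(V)<1$, then there is a constant $C<\infty$ such that, for all $z\in\mathbb C\setminus\mathbb R$ and all $x,y\in\mathbb Z^d$, the operator $z-H(\mathfrak e,V)$ is boundedly invertible and $$\big|\langle\delta_x,(z-H(\mathfrak e,V))^{-1}\delta_y\rangle\big|\le C(1+|x|)^2(1+|y|)^2 .$$ (ii) If $2c\,\Phi_{2,3}(V)<1$, then $i[H(\mathfrak e,V),A]$ extends uniquely to a bounded operator on $\ell^2(\mathbb Z^d)$, and there is a constant $C<\infty$ such that, for all $z\in\mathbb C\setminus\mathbb R$ and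 all $x,y\in\mathbb Z^d$, the operator $z-i[H(\mathfrak e,V),A]$ is boundedly invertible and $$\big|\langle\delta_x,(z-i[H(\mathfrak e,V),A])^{-1}\delta_y\rangle\big|\le C(1+|x|)^2(1+|y|)^2 .$$ -/

import Mathlib

open MeasureTheory
open scoped ENNReal ContDiff InnerProductSpace

namespace LatticeSchrodinger

noncomputable section

/-! ### The lattice, the Brillouin zone and the Fourier transform -/

/-- The hypercubic lattice `ℤᵈ`. -/
abbrev Lattice (d : ℕ) : Type := Fin d → ℤ

/-- Euclidean length of a lattice point. -/
def eucl {d : ℕ} (x : Lattice d) : ℝ := Real.sqrt (∑ i, (x i : ℝ) ^ 2)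

/-- The Hilbert space `ℓ²(ℤᵈ; ℂ)`. -/
abbrev SeqSpace (d : ℕ) : Type := lp (fun _ : Lattice d => ℂ) 2

/-- The normalized vector `δ_x`. -/
def delta {d : ℕ} (x : Lattice d) : SeqSpace d := lp.single 2 x (1 : ℂ)

/-- The normalized measure `dp / (2π)` on `[-π, π)`. -/
def brillouinMeasure₁ : Measure ℝ :=
  (ENNReal.ofReal (2 * Real.pi))⁻¹ • (volume.restrict (Set.Ico (-Real.pi) Real.pi))

/-- The normalized Haar measure `dᵈp / (2π)ᵈ` of the torus `(ℝ / 2πℤ)ᵈ`, realized on the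
fundamental domain `[-π, π)ᵈ`. -/
def brillouinMeasure (d : ℕ) : Measure (Fin d → ℝ) :=
  Measure.pi fun _ => brillouinMeasure₁

/-- The Hilbert space `L²` of the torus. -/
abbrev MomentumSpace (d : ℕ) : Type := Lp ℂ 2 (brillouinMeasure d)

/-- `f` is a function on the torus `(ℝ / 2πℤ)ᵈ`, i.e. it is `2π`-periodic in each coordinate. -/
def TorusPeriodic {d : ℕ} {E : Type*} (f : (Fin d → ℝ) → E) : Prop :=
  ∀ (p : Fin d → ℝ) (i : Fin d), f (p + Pi.single i (2 * Real.pi)) = f p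

/-- The character `p ↦ exp (-i ⟨p, x⟩)`. -/
def character {d : ℕ} (x : Lattice d) (p : Fin d → ℝ) : ℂ :=
  Complex.exp (-(Complex.I * ∑ i, (p i : ℂ) * (x i : ℂ)))

lemma measurePreserving_circle :
    MeasurePreserving (fun p : ℝ => ((p / (2 * Real.pi) : ℝ) : UnitAddCircle))
      brillouinMeasure₁ AddCircle.haarAddCircle := by
  have hpi : 0 < 2 * Real.pi := by positivity
  have h1 : MeasurePreserving (fun p : ℝ => p / (2 * Real.pi)) brillouinMeasure₁
      (volume.restrict (Set.Ioc (-(1 / 2) : ℝ) (-(1 / 2) + 1))) := by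
    refine ⟨by fun_prop, ?_⟩
    have hmeas : Measurable (fun p : ℝ => p / (2 * Real.pi)) := by fun_prop
    have hpre : (fun p : ℝ => p / (2 * Real.pi)) ⁻¹' (Set.Ioc (-(1 / 2) : ℝ) (-(1 / 2) + 1))
        = Set.Ioc (-Real.pi) Real.pi := by
      ext p
      simp only [Set.mem_preimage, Set.mem_Ioc]
      rw [lt_div_iff₀ hpi, div_le_iff₀ hpi]
      constructor <;> rintro ⟨h, h'⟩ <;> constructor <;> linarith
    have hmap : Measure.map (fun p : ℝ => p / (2 * Real.pi)) volume
        = ENNReal.ofReal (2 * Real.pi) • (volume : Measure ℝ) := by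
      simp_rw [div_eq_mul_inv]
      rw [Real.map_volume_mul_right (inv_ne_zero hpi.ne'), inv_inv, abs_of_pos hpi]
    rw [brillouinMeasure₁, Measure.restrict_congr_set Ico_ae_eq_Ioc, Measure.map_smul, ← hpre,
      ← Measure.restrict_map hmeas measurableSet_Ioc, hmap, Measure.restrict_smul, smul_smul,
      ENNReal.inv_mul_cancel (by simpa using hpi) ENNReal.ofReal_ne_top, one_smul]
  have h2 := UnitAddCircle.measurePreserving_mk (-(1 / 2))
  have h3 : (volume : Measure UnitAddCircle) = AddCircle.haarAddCircle := by
    rw [AddCircle.volume_eq_smul_haarAddCircle]; simp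
  rw [h3] at h2
  exact h2.comp h1

instance : IsProbabilityMeasure brillouinMeasure₁ where
  measure_univ := by
    have := measurePreserving_circle.measure_preimage (s := Set.univ) (by simp)
    simpa using this

instance (d : ℕ) : IsProbabilityMeasure (brillouinMeasure d) := by
  unfold brillouinMeasure; infer_instance

/-- The class in `L²` of a function of the quasi-momentum (zero if it is not square integrable;
continuous functions always are, see `memLp_of_continuous`). -/
def toMomentum {d : ℕ} (f : (Fin d → ℝ) → ℂ) : MomentumSpace d :=
  open Classical in if h : MemLp f 2 (brillouinMeasure d) then h.toLp f else 0

/-- The operator of multiplication by `f` on `L²` of the torus (zero if `f` is not essentially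
bounded; continuous functions always are, see `memLp_of_continuous`). -/
def multiplication {d : ℕ} (f : (Fin d → ℝ) → ℂ) : MomentumSpace d →L[ℂ] MomentumSpace d :=
  open Classical in
  if h : MemLp f ∞ (brillouinMeasure d) then
    (ContinuousLinearMap.mul ℂ ℂ).holderL (brillouinMeasure d) ∞ 2 2 (h.toLp f)
  else 0

lemma ae_mem_cube (d : ℕ) :
    ∀ᵐ p ∂(brillouinMeasure d), ∀ i, p i ∈ Set.Ico (-Real.pi) Real.pi := by
  rw [ae_all_iff]
  intro i
  have h : ∀ᵐ q ∂brillouinMeasure₁, q ∈ Set.Ico (-Real.pi) Real.pi := by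
    unfold brillouinMeasure₁
    exact Measure.ae_smul_measure (ae_restrict_mem measurableSet_Ico) _
  exact (measurePreserving_eval (fun _ : Fin d => brillouinMeasure₁) i).quasiMeasurePreserving.ae h

lemma memLp_of_continuous {d : ℕ} {f : (Fin d → ℝ) → ℂ} (hf : Continuous f) (r : ℝ≥0∞) :
    MemLp f r (brillouinMeasure d) := by
  have hK : IsCompact (Set.Icc (fun _ : Fin d => -Real.pi) (fun _ => Real.pi)) := isCompact_Icc
  obtain ⟨C, hC⟩ := hK.exists_bound_of_continuousOn hf.continuousOn
  have htop : MemLp f ∞ (brillouinMeasure d) := by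
    refine memLp_top_of_bound hf.aestronglyMeasurable C ?_
    filter_upwards [ae_mem_cube d] with p hp
    exact hC p ⟨fun i => (hp i).1, fun i => (hp i).2.le⟩
  exact htop.mono_exponent le_top

lemma continuous_character {d : ℕ} (x : Lattice d) : Continuous (character x) := by
  unfold character; fun_prop

/-- The projection of the momenta onto the product of unit circles. -/
def circleProj (d : ℕ) (p : Fin d → ℝ) : UnitAddTorus (Fin d) :=
  fun i => ((p i / (2 * Real.pi) : ℝ) : UnitAddCircle)

/-- The standard section of `circleProj`. -/
def circleSection (d : ℕ) (t : UnitAddTorus (Fin d)) : Fin d → ℝ :=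
  fun i => 2 * Real.pi * (AddCircle.equivIco 1 (-(1 / 2)) (t i) : ℝ)

lemma measurePreserving_circleProj (d : ℕ) :
    MeasurePreserving (circleProj d) (brillouinMeasure d)
      (Measure.pi fun _ => AddCircle.haarAddCircle) :=
  measurePreserving_pi _ _ fun _ => measurePreserving_circle

lemma measurable_circleSection (d : ℕ) : Measurable (circleSection d) := by
  refine measurable_pi_lambda _ fun i => ?_
  have h : Measurable (fun s : UnitAddCircle => (AddCircle.equivIco 1 (-(1 / 2)) s : ℝ)) :=
    measurable_subtype_coe.comp (AddCircle.measurableEquivIco (1 : ℝ) (-(1 / 2))).measurable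
  exact (h.comp (measurable_pi_apply i)).const_mul _

lemma circleSection_circleProj (d : ℕ) :
    circleSection d ∘ circleProj d =ᵐ[brillouinMeasure d] id := by
  filter_upwards [ae_mem_cube d] with p hp
  funext i
  have hpi : 0 < 2 * Real.pi := by positivity
  have hmem : p i / (2 * Real.pi) ∈ Set.Ico (-(1 / 2) : ℝ) (-(1 / 2) + 1) := by
    rw [Set.mem_Ico, le_div_iff₀ hpi, div_lt_iff₀ hpi]
    constructor <;> linarith [(hp i).1, (hp i).2]
  have h : AddCircle.equivIco (1 : ℝ) (-(1 / 2)) ((p i / (2 * Real.pi) : ℝ) : AddCircle (1 : ℝ))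
      = p i / (2 * Real.pi) := AddCircle.equivIco_coe_of_mem hmem
  change 2 * Real.pi * _ = p i
  erw [h]
  field_simp

lemma measurePreserving_circleSection (d : ℕ) :
    MeasurePreserving (circleSection d) (Measure.pi fun _ => AddCircle.haarAddCircle)
      (brillouinMeasure d) := by
  refine ⟨measurable_circleSection d, ?_⟩
  rw [← (measurePreserving_circleProj d).map_eq,
    Measure.map_map (measurable_circleSection d) (measurePreserving_circleProj d).measurable,
    Measure.map_congr (circleSection_circleProj d), Measure.map_id]

/-- Pull-back along `circleProj`, as an isometry of `L²` spaces. -/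
def pullback (d : ℕ) :
    Lp ℂ 2 (Measure.pi fun _ : Fin d => (AddCircle.haarAddCircle : Measure UnitAddCircle))
      →ₗᵢ[ℂ] MomentumSpace d :=
  Lp.compMeasurePreservingₗᵢ ℂ (circleProj d) (measurePreserving_circleProj d)

lemma pullback_surjective (d : ℕ) : Function.Surjective (pullback d) := by
  intro g
  refine ⟨Lp.compMeasurePreserving (circleSection d) (measurePreserving_circleSection d) g, ?_⟩
  have hq := (measurePreserving_circleProj d)
  have hs := (measurePreserving_circleSection d)
  change Lp.compMeasurePreserving (circleProj d) hq (Lp.compMeasurePreserving _ hs g) = g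
  refine Lp.ext ?_
  have h1 := Lp.coeFn_compMeasurePreserving (Lp.compMeasurePreserving _ hs g) hq
  have h2 := hq.quasiMeasurePreserving.ae_eq_comp (Lp.coeFn_compMeasurePreserving g hs)
  filter_upwards [h1, h2, circleSection_circleProj d] with p e1 e2 e3
  rw [e1, e2]
  exact congrArg g e3

lemma toMomentum_character {d : ℕ} (x : Lattice d) :
    toMomentum (character x) = pullback d (UnitAddTorus.mFourierLp 2 (-x)) := by
  have hq := (measurePreserving_circleProj d)
  have hm := memLp_of_continuous (continuous_character x) 2
  rw [toMomentum, dif_pos hm]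
  refine Lp.ext ?_
  have h1 := Lp.coeFn_compMeasurePreserving (UnitAddTorus.mFourierLp 2 (-x)) hq
  have h2 := hq.quasiMeasurePreserving.ae_eq_comp (UnitAddTorus.coeFn_mFourierLp 2 (-x))
  filter_upwards [hm.coeFn_toLp, h1, h2] with p e0 e1 e2
  rw [e0]
  refine Eq.trans ?_ e1.symm
  rw [e2]
  simp only [Function.comp, UnitAddTorus.mFourier, ContinuousMap.coe_mk, circleProj, character,
    Pi.neg_apply]
  rw [Finset.mul_sum, ← Finset.sum_neg_distrib, Complex.exp_sum]
  refine Finset.prod_congr rfl fun i _ => ?_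
  rw [fourier_coe_apply]
  congr 1
  have : (Real.pi : ℂ) ≠ 0 := by exact_mod_cast Real.pi_ne_zero
  push_cast
  field_simp

lemma orthonormal_character (d : ℕ) :
    Orthonormal ℂ fun x : Lattice d => toMomentum (character x) := by
  have h := (UnitAddTorus.orthonormal_mFourier (d := Fin d)).comp (fun x : Lattice d => -x)
    neg_injective
  have h' := h.comp_linearIsometry (pullback d)
  convert h' using 1
  funext x
  exact toMomentum_character x

lemma span_character (d : ℕ) :
    ⊤ ≤ (Submodule.span ℂ
      (Set.range fun x : Lattice d => toMomentum (character x))).topologicalClosure := by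
  intro g _
  obtain ⟨f, rfl⟩ := pullback_surjective d g
  have hf : f ∈ (Submodule.span ℂ (Set.range
      (UnitAddTorus.mFourierLp (d := Fin d) 2))).topologicalClosure := by
    have := UnitAddTorus.span_mFourierLp_closure_eq_top (d := Fin d) (p := 2) (by simp)
    exact this.ge (Submodule.mem_top)
  have himg := image_closure_subset_closure_image (pullback d).continuous
    (Set.mem_image_of_mem _ hf)
  refine closure_mono ?_ himg
  rintro _ ⟨a, ha, rfl⟩
  have ha' : (pullback d) a ∈ (Submodule.span ℂ (Set.range
      (UnitAddTorus.mFourierLp (d := Fin d) 2))).map (pullback d).toLinearMap :=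
    Submodule.mem_map_of_mem ha
  rw [Submodule.map_span] at ha'
  refine Submodule.span_mono ?_ ha'
  rintro _ ⟨_, ⟨n, rfl⟩, rfl⟩
  exact ⟨-n, by simp [toMomentum_character]⟩

/-- The characters form a Hilbert basis of `L²` of the torus. -/
def characterBasis (d : ℕ) : HilbertBasis (Lattice d) ℂ (MomentumSpace d) :=
  HilbertBasis.mk (orthonormal_character d) (span_character d)

/-- The unitary Fourier transform from `L²` of the torus onto `ℓ²(ℤᵈ)`,
`(F ψ)(x) = ∫ exp (i ⟨p, x⟩) ψ(p) dp / (2π)ᵈ`. Its inverse maps `ψ` to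
`∑ₓ ψ(x) exp (-i ⟨p, x⟩)`. -/
def latticeFourier (d : ℕ) : MomentumSpace d ≃ₗᵢ[ℂ] SeqSpace d := (characterBasis d).repr

lemma latticeFourier_apply_eq_integral {d : ℕ} {f : (Fin d → ℝ) → ℂ} (hf : Continuous f)
    (x : Lattice d) :
    latticeFourier d (toMomentum f) x
      = ∫ p, Complex.exp (Complex.I * ∑ i, (p i : ℂ) * (x i : ℂ)) * f p
          ∂(brillouinMeasure d) := by
  have hm := memLp_of_continuous (continuous_character x) 2
  have hm' := memLp_of_continuous hf 2
  rw [latticeFourier, HilbertBasis.repr_apply_apply, characterBasis, HilbertBasis.coe_mk, toMomentum,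
    toMomentum, dif_pos hm, dif_pos hm', L2.inner_def]
  refine integral_congr_ae ?_
  filter_upwards [hm.coeFn_toLp, hm'.coeFn_toLp] with p e1 e2
  rw [e1, e2]
  simp only [RCLike.inner_apply, character]
  rw [mul_comm, ← Complex.exp_conj]
  congr 2
  simp [map_sum]

/-! ### Dispersion relations and Morse functions -/

/-- The partial derivative `∂f / ∂pᵢ`. -/
def partialDeriv {d : ℕ} {E : Type*} [NormedAddCommGroup E] [NormedSpace ℝ E]
    (i : Fin d) (f : (Fin d → ℝ) → E) (p : Fin d → ℝ) : E :=
  fderiv ℝ f p (Pi.single i 1)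

/-- `|∇e|²`. -/
def gradSq {d : ℕ} (e : (Fin d → ℝ) → ℝ) (p : Fin d → ℝ) : ℝ :=
  ∑ i, (partialDeriv i e p) ^ 2

/-- The Hessian matrix of `f` at `p`. -/
def hessian {d : ℕ} (f : (Fin d → ℝ) → ℝ) (p : Fin d → ℝ) : Matrix (Fin d) (Fin d) ℝ :=
  Matrix.of fun i j => partialDeriv i (partialDeriv j f) p

/-- Morse functions: `C²`, with non-degenerate Hessian at every critical point. -/
def IsMorse {d : ℕ} (f : (Fin d → ℝ) → ℝ) : Prop :=
  ContDiff ℝ 2 f ∧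
    ∀ p, (∀ i, partialDeriv i f p = 0) → (hessian f p).det ≠ 0

/-- Condition (M): `e` and `|∇e|²` are Morse functions. -/
def ConditionM {d : ℕ} (e : (Fin d → ℝ) → ℝ) : Prop :=
  IsMorse e ∧ IsMorse (gradSq e)

/-! ### Potentials and the Schrödinger operator -/

/-- The bounded real potentials `ℓ^∞(ℤᵈ; ℝ)`. -/
abbrev Potential (d : ℕ) : Type := lp (fun _ : Lattice d => ℝ) ∞

/-- `Φ_{m,n}(V) = (∑ₓ |V(x)|^{1/m} (|x| + 1)ⁿ)^m`, with values in `[0, ∞]`. -/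
def Phi {d : ℕ} (m n : ℕ) (V : Lattice d → ℝ) : ℝ≥0∞ :=
  (∑' x, ENNReal.ofReal (|V x| ^ (1 / (m : ℝ)) * (eucl x + 1) ^ n)) ^ m

lemma norm_potential_mul_le {d : ℕ} (V : Potential d) (ψ : SeqSpace d) (x : Lattice d) :
    ‖(V x : ℂ) * ψ x‖ ≤ ‖((‖V‖ : ℝ) : ℂ) • ψ x‖ := by
  rw [norm_mul, norm_smul, Complex.norm_real, Complex.norm_real, norm_norm]
  exact mul_le_mul_of_nonneg_right (lp.norm_apply_le_norm (by simp) V x) (norm_nonneg _)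

lemma memlp_potential_mul {d : ℕ} (V : Potential d) (ψ : SeqSpace d) :
    Memℓp (fun x => (V x : ℂ) * ψ x) 2 := by
  have h := lp.memℓp (((‖V‖ : ℝ) : ℂ) • ψ)
  exact h.mono' (norm_potential_mul_le V ψ)

/-- The operator of multiplication by the potential `V` on `ℓ²(ℤᵈ)`. -/
def potentialOp {d : ℕ} (V : Potential d) : SeqSpace d →L[ℂ] SeqSpace d :=
  LinearMap.mkContinuous
    { toFun := fun ψ => ⟨fun x => (V x : ℂ) * ψ x, memlp_potential_mul V ψ⟩
      map_add' := fun ψ φ => by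
        ext x
        change (V x : ℂ) * (ψ x + φ x) = (V x : ℂ) * ψ x + (V x : ℂ) * φ x
        ring
      map_smul' := fun c ψ => by
        ext x
        change (V x : ℂ) * (c * ψ x) = c * ((V x : ℂ) * ψ x)
        ring }
    ‖V‖ (fun ψ => by
      have h : ‖(⟨fun x => (V x : ℂ) * ψ x, memlp_potential_mul V ψ⟩ : SeqSpace d)‖
          ≤ ‖((‖V‖ : ℝ) : ℂ) • ψ‖ :=
        lp.norm_mono (by simp) (norm_potential_mul_le V ψ)
      rw [norm_smul, Complex.norm_real, norm_norm] at h
      exact h)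

/-- The hopping matrix `h(e) = F e F*`. -/
def hopping {d : ℕ} (e : (Fin d → ℝ) → ℝ) : SeqSpace d →L[ℂ] SeqSpace d :=
  (latticeFourier d : MomentumSpace d →L[ℂ] SeqSpace d) ∘L multiplication (fun p => (e p : ℂ)) ∘L
    ((latticeFourier d).symm : SeqSpace d →L[ℂ] MomentumSpace d)

/-- The lattice Schrödinger operator `H(e, V) = h(e) + V`. -/
def hamiltonian {d : ℕ} (e : (Fin d → ℝ) → ℝ) (V : Potential d) : SeqSpace d →L[ℂ] SeqSpace d :=
  hopping e + potentialOp V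

/-! ### The conjugate operator and the commutator -/

/-- The differential expression
`(Â g)(p) = i ∑ₖ ((∂ₖe)(p) (∂ₖg)(p) + (1/2) (∂ₖ²e)(p) g(p))`. -/
def conjugateExpr {d : ℕ} (e : (Fin d → ℝ) → ℝ) (g : (Fin d → ℝ) → ℂ) (p : Fin d → ℝ) : ℂ :=
  Complex.I * ∑ k, (Complex.ofReal (partialDeriv k e p) * partialDeriv k g p
    + (1 / 2 : ℂ) * Complex.ofReal (partialDeriv k (partialDeriv k e) p) * g p)

/-- The graph of the operator `A = A(e) = F Â F*` with domain `F (C^∞)`, where `C^∞` denotes the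
smooth functions on the torus. -/
def conjugateGraph {d : ℕ} (e : (Fin d → ℝ) → ℝ) : Set (SeqSpace d × SeqSpace d) :=
  {u | ∃ g : (Fin d → ℝ) → ℂ, ContDiff ℝ ∞ g ∧ TorusPeriodic g ∧
    u.1 = latticeFourier d (toMomentum g) ∧ u.2 = latticeFourier d (toMomentum (conjugateExpr e g))}

/-- The bounded operator `B` is the extension of the commutator `i[H, A(e)] = i(HA - AH)`, the
latter being understood as a sesquilinear form on the domain of `A(e)`: for all `φ, ψ` in this
domain, `⟨φ, B ψ⟩ = i (⟨H φ, A ψ⟩ - ⟨A φ, H ψ⟩)` (here `H` is self-adjoint and `A` symmetric).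
Equivalently, `H ψ` lies in the domain of the adjoint `A*` and `B ψ = i (H A ψ - A* H ψ)`. As the
domain of `A(e)` is dense, there is at most one such `B`. -/
def IsCommutator {d : ℕ} (e : (Fin d → ℝ) → ℝ) (H B : SeqSpace d →L[ℂ] SeqSpace d) : Prop :=
  ∀ u ∈ conjugateGraph e, ∀ v ∈ conjugateGraph e,
    ⟪u.1, B v.1⟫_ℂ = Complex.I * (⟪H u.1, v.2⟫_ℂ - ⟪u.2, H v.1⟫_ℂ)

/-- The weighted resolvent estimate
`|⟨δ_x, (z - T)⁻¹ δ_y⟩| ≤ C (1 + |x|)² (1 + |y|)²` for all non-real `z` and all `x, y`, where the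
constant `C` does not depend on `z, x, y`, together with the invertibility of `z - T`. -/
def ResolventEstimate {d : ℕ} (T : SeqSpace d →L[ℂ] SeqSpace d) : Prop :=
  ∃ C : ℝ, ∀ z : ℂ, z.im ≠ 0 → z ∈ resolventSet ℂ T ∧
    ∀ x y : Lattice d,
      ‖⟪delta x, resolvent T z (delta y)⟫_ℂ‖ ≤ C * (1 + eucl x) ^ 2 * (1 + eucl y) ^ 2

end

end LatticeSchrodinger

open LatticeSchrodinger

namespace LatticeSchrodinger

/-! ### Integration over the Brillouin zone -/

/-! Both estimates come from one bound on free resolvents plus a perturbation argument. In momentum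
space a matrix element of the resolvent of multiplication by `f` is `∫ g / (z - f)`, with `g` the
product of a conjugated and an unconjugated test function. It must be bounded by the C¹ size of `g`,
uniformly in non-real `z`, whenever `f` is periodic and Morse and `d ≥ 3`
(`IsMorse.exists_norm_integral_div_le`).

Since `1 / (z - s)` is the derivative of `-log (z - s)`, integration by parts along the field `∇f /
|∇f|²` replaces the singular kernel by a logarithm; the divergence of `g ∇f / |∇f|²` costs at most a
constant times `|∇f|⁻²` (`IsMorse.exists_norm_integral_deriv_comp_mul_le`). It remains to bound `∫
|log (z - f)| |∇f|⁻²`. Up to an integrable remainder, Young's inequality splits the integrand into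
`|z - f|^(-1/2)` and `|∇f|^(-5/2)`. The second is integrable because `|∇f|` vanishes at most
linearly at the non-degenerate critical points and `5/2 < 3 ≤ d`. The first is treated by the same
integration by parts with the locally bounded primitive `rootPrimitive`. For large `|z|` the bound
is trivial.

The perturbation is a sum of rank-one operators between such test functions, and the second
resolvent identity closes into a linear inequality when their total weight is small
(`norm_inner_sub_le_of_hasSum`, `resolventEstimate_of_hasSum`). For the Hamiltonian these are `V(x)
|δₓ⟩⟨δₓ|`, and `f = e`. The commutator is multiplication by `|∇e|²` plus two families built from
`δₓ` and `A δₓ`; this is where the Morse property of `|∇e|²` enters. All these vectors have C¹ size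
of order at most `(1 + |x|)²`, so the quantity to be small is `∑ |V(x)| (1 + |x|)⁴`, which is
dominated by `Phi` (`summable_of_mul_Phi_lt_one`). -/

/-- The closed cube `[-π, π]ᵈ`. -/
abbrev cube (d : ℕ) : Set (Fin d → ℝ) := Set.Icc (fun _ => -Real.pi) (fun _ => Real.pi)

lemma brillouinMeasure_eq_restrict_pi (d : ℕ) :
    brillouinMeasure d = ((ENNReal.ofReal (2 * Real.pi))⁻¹) ^ d •
      (volume : Measure (Fin d → ℝ)).restrict
        (Set.univ.pi fun _ => Set.Ico (-Real.pi) Real.pi) := by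
  refine Measure.pi_eq fun s hs => ?_
  rw [volume_pi, Measure.restrict_pi_pi, Measure.smul_apply, Measure.pi_pi, smul_eq_mul]
  simp [brillouinMeasure₁, Finset.prod_mul_distrib]

lemma brillouinMeasure_eq (d : ℕ) :
    brillouinMeasure d = ((ENNReal.ofReal (2 * Real.pi))⁻¹) ^ d •
      (volume : Measure (Fin d → ℝ)).restrict (cube d) := by
  rw [brillouinMeasure_eq_restrict_pi]
  congr 1
  exact Measure.restrict_congr_set Measure.univ_pi_Ico_ae_eq_Icc

lemma brillouinMeasure_factor_ne_top (d : ℕ) :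
    ((ENNReal.ofReal (2 * Real.pi))⁻¹) ^ d ≠ ⊤ := by
  refine ENNReal.pow_ne_top (ENNReal.inv_ne_top.2 ?_)
  simpa using Real.pi_pos

lemma ae_mem_closedCube (d : ℕ) : ∀ᵐ p ∂(brillouinMeasure d), p ∈ cube d := by
  filter_upwards [ae_mem_cube d] with p hp
  exact ⟨fun i => (hp i).1, fun i => (hp i).2.le⟩

lemma brillouinMeasure_absolutelyContinuous (d : ℕ) : brillouinMeasure d ≪ volume := by
  rw [brillouinMeasure_eq]
  exact (Measure.smul_absolutelyContinuous).trans Measure.absolutelyContinuous_restrict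

lemma integrable_brillouin_of_locallyIntegrable {d : ℕ} {E : Type*} [NormedAddCommGroup E]
    {f : (Fin d → ℝ) → E} (hf : LocallyIntegrable f) : Integrable f (brillouinMeasure d) := by
  rw [brillouinMeasure_eq]
  exact (hf.integrableOn_isCompact isCompact_Icc).smul_measure (brillouinMeasure_factor_ne_top d)

lemma integrable_brillouin_of_continuous {d : ℕ} {E : Type*} [NormedAddCommGroup E]
    {f : (Fin d → ℝ) → E} (hf : Continuous f) : Integrable f (brillouinMeasure d) :=
  integrable_brillouin_of_locallyIntegrable hf.locallyIntegrable

lemma continuous_partialDeriv {d : ℕ} {E : Type*} [NormedAddCommGroup E] [NormedSpace ℝ E]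
    {f : (Fin d → ℝ) → E} (hf : ContDiff ℝ 1 f) (i : Fin d) : Continuous (partialDeriv i f) :=
  (hf.continuous_fderiv one_ne_zero).clm_apply continuous_const

lemma contDiff_partialDeriv {d : ℕ} {E : Type*} [NormedAddCommGroup E] [NormedSpace ℝ E]
    {f : (Fin d → ℝ) → E} {m n : WithTop ℕ∞} (hf : ContDiff ℝ n f) (hmn : m + 1 ≤ n)
    (i : Fin d) : ContDiff ℝ m (partialDeriv i f) :=
  (hf.fderiv_right hmn).clm_apply contDiff_const

lemma TorusPeriodic.partialDeriv {d : ℕ} {E : Type*} [NormedAddCommGroup E] [NormedSpace ℝ E]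
    {f : (Fin d → ℝ) → E} (hf : TorusPeriodic f) (i : Fin d) :
    TorusPeriodic (partialDeriv i f) := by
  intro p k
  have h : (fun q => f (q + Pi.single k (2 * Real.pi))) = f := funext fun q => hf q k
  unfold LatticeSchrodinger.partialDeriv
  rw [← fderiv_comp_add_right, h]

/-- The integral of a partial derivative of a periodic function vanishes. -/
theorem integral_partialDeriv_eq_zero {d : ℕ} {F : (Fin d → ℝ) → ℂ} (hF : ContDiff ℝ 1 F)
    (hper : TorusPeriodic F) (i : Fin d) :
    ∫ p, partialDeriv i F p ∂(brillouinMeasure d) = 0 := by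
  obtain _ | n := d
  · exact i.elim0
  rw [brillouinMeasure_eq, integral_smul_measure]
  have hle : (fun _ : Fin (n + 1) => -Real.pi) ≤ fun _ => Real.pi := fun _ => by
    have := Real.pi_pos; simp only; linarith
  -- Divergence theorem for the field with `F` in slot `i` and zero elsewhere; only the two faces
  -- orthogonal to direction `i` can contribute.
  have key := integral_divergence_of_hasFDerivAt_off_countable' (fun _ : Fin (n + 1) => -Real.pi)
    (fun _ => Real.pi) hle (fun j => if j = i then F else 0)
    (fun j p => if j = i then fderiv ℝ F p else 0) ∅ Set.countable_empty
    (fun j => by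
      by_cases h : j = i
      · simpa [h] using hF.continuous.continuousOn
      · simp only [h, if_false]; exact continuousOn_const)
    (fun p _ j => by
      by_cases h : j = i
      · simpa [h] using (hF.differentiable one_ne_zero p).hasFDerivAt
      · simp only [h, if_false]; exact hasFDerivAt_const (0 : ℂ) p)
    (by
      have h : (fun p => ∑ j, (if j = i then fderiv ℝ F p else 0) (Pi.single j 1))
          = partialDeriv i F := by
        funext p
        rw [Finset.sum_eq_single i] <;> simp +contextual [partialDeriv]
      rw [h]
      exact (continuous_partialDeriv hF i).continuousOn.integrableOn_compact isCompact_Icc)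
  have h : (fun p => ∑ j, (if j = i then fderiv ℝ F p else 0) (Pi.single j 1))
      = partialDeriv i F := by
    funext p
    rw [Finset.sum_eq_single i] <;> simp +contextual [partialDeriv]
  rw [h] at key
  rw [key, Finset.sum_eq_zero, smul_zero]
  intro j _
  by_cases hj : j = i
  · subst hj
    simp only [if_true]
    -- The opposite faces differ by a shift of `2π` in direction `j`, so their contributions cancel
    -- by periodicity.
    rw [sub_eq_zero]
    congr 1
    funext q
    rw [← hper (Fin.insertNth j (-Real.pi) q) j]
    congr 1
    funext k
    rcases eq_or_ne k j with rfl | hk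
    · simp; ring
    · obtain ⟨l, rfl⟩ := Fin.exists_succAbove_eq hk
      simp [Fin.succAbove_ne]
  · simp [hj]

/-! ### Integrability of negative powers of the gradient of a Morse function -/

lemma gradSq_nonneg {d : ℕ} (f : (Fin d → ℝ) → ℝ) (p : Fin d → ℝ) : 0 ≤ gradSq f p :=
  Finset.sum_nonneg fun _ _ => sq_nonneg _

lemma partialDeriv_sq_le_gradSq {d : ℕ} (f : (Fin d → ℝ) → ℝ) (p : Fin d → ℝ) (i : Fin d) :
    partialDeriv i f p ^ 2 ≤ gradSq f p :=
  Finset.single_le_sum (f := fun j => partialDeriv j f p ^ 2) (fun _ _ => sq_nonneg _)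
    (Finset.mem_univ i)

lemma gradSq_eq_zero_iff {d : ℕ} {f : (Fin d → ℝ) → ℝ} {p : Fin d → ℝ} :
    gradSq f p = 0 ↔ ∀ i, partialDeriv i f p = 0 := by
  unfold gradSq
  rw [Finset.sum_eq_zero_iff_of_nonneg fun _ _ => sq_nonneg _]
  simp

lemma contDiff_gradSq {d : ℕ} {f : (Fin d → ℝ) → ℝ} {m n : WithTop ℕ∞} (hf : ContDiff ℝ n f)
    (hmn : m + 1 ≤ n) : ContDiff ℝ m (gradSq f) :=
  ContDiff.sum fun i _ => (contDiff_partialDeriv hf hmn i).pow 2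

lemma TorusPeriodic.gradSq {d : ℕ} {f : (Fin d → ℝ) → ℝ} (hf : TorusPeriodic f) :
    TorusPeriodic (gradSq f) := fun p k => by
  simp only [LatticeSchrodinger.gradSq, hf.partialDeriv _ p k]

/-- Near a critical point `p` of a Morse function, `|∇f(q)|² ≥ c |q - p|²`. -/
lemma IsMorse.exists_le_gradSq {d : ℕ} {f : (Fin d → ℝ) → ℝ} (hf : IsMorse f) {p : Fin d → ℝ}
    (hp : gradSq f p = 0) : ∃ c > 0, ∀ᶠ q in nhds p, c * ‖q - p‖ ^ 2 ≤ gradSq f q := by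
  have hcrit := gradSq_eq_zero_iff.1 hp
  have hdet := hf.2 p hcrit
  set G : (Fin d → ℝ) → (Fin d → ℝ) := fun q i => partialDeriv i f q with hG
  set D : (Fin d → ℝ) →L[ℝ] (Fin d → ℝ) :=
    ContinuousLinearMap.pi fun i => fderiv ℝ (partialDeriv i f) p with hD
  have hGD : HasFDerivAt G D p := hasFDerivAt_pi.2 fun i =>
    (((contDiff_partialDeriv hf.1 (m := 1) (by norm_num) i).differentiable one_ne_zero) p).hasFDerivAt
  -- Left multiplication matches the index order of `hessian`, so symmetry of second derivatives is
  -- not needed.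
  have hDv : ∀ v, D v = Matrix.vecMul v (hessian f p) := by
    intro v
    funext i
    have hv : v = ∑ j, v j • (Pi.single j (1 : ℝ) : Fin d → ℝ) := by
      funext k; simp [Finset.sum_apply, Pi.single_apply]
    calc D v i = fderiv ℝ (partialDeriv i f) p v := rfl
      _ = ∑ j, v j * hessian f p j i := by
        conv_lhs => rw [hv]
        simp [map_sum, hessian, partialDeriv]
      _ = _ := rfl
  have hker : LinearMap.ker (D : (Fin d → ℝ) →ₗ[ℝ] (Fin d → ℝ)) = ⊥ := by
    rw [LinearMap.ker_eq_bot']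
    intro v hv
    exact Matrix.eq_zero_of_vecMul_eq_zero hdet (by rw [← hDv]; exact hv)
  obtain ⟨K, hK0, hK⟩ := LinearMap.exists_antilipschitzWith _ hker
  have hKpos : (0 : ℝ) < K := hK0
  have hlow : ∀ v, ‖v‖ ≤ K * ‖D v‖ := fun v => by
    simpa using hK.le_mul_norm (by simp) v
  refine ⟨(1 / (2 * K)) ^ 2, by positivity, ?_⟩
  -- The linear part is at least `‖q - p‖ / K`; a remainder of at most half of that leaves the other
  -- half.
  have hlit := hGD.isLittleO.def (c := 1 / (2 * K)) (by positivity)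
  filter_upwards [hlit] with q hq
  have hGp : G p = 0 := funext hcrit
  rw [hGp, sub_zero] at hq
  have h1 : ‖D (q - p)‖ ≤ ‖G q‖ + ‖G q - D (q - p)‖ := by
    have := norm_sub_le (G q) (G q - D (q - p))
    simpa using this
  have h2 : 1 / (2 * K) * ‖q - p‖ ≤ ‖G q‖ := by
    have h3 : ‖q - p‖ / K ≤ ‖D (q - p)‖ := by
      rw [div_le_iff₀ hKpos, mul_comm]; exact hlow _
    have h4 : ‖q - p‖ / K = 1 / (2 * K) * ‖q - p‖ + 1 / (2 * K) * ‖q - p‖ := by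
      field_simp; ring
    linarith
  have h5 : ‖G q‖ ≤ Real.sqrt (gradSq f q) :=
    (pi_norm_le_iff_of_nonneg (Real.sqrt_nonneg _)).2 fun i =>
      Real.abs_le_sqrt (partialDeriv_sq_le_gradSq f q i)
  calc (1 / (2 * (K : ℝ))) ^ 2 * ‖q - p‖ ^ 2 = (1 / (2 * K) * ‖q - p‖) ^ 2 := by ring
    _ ≤ Real.sqrt (gradSq f q) ^ 2 := by gcongr; exact h2.trans h5
    _ = gradSq f q := Real.sq_sqrt (gradSq_nonneg f q)

lemma continuous_gradSq {d : ℕ} {f : (Fin d → ℝ) → ℝ} (hf : ContDiff ℝ 1 f) :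
    Continuous (gradSq f) :=
  (contDiff_gradSq (m := 0) hf (by norm_num)).continuous

/-- Non-degeneracy isolates the critical points, so their set is locally contained in a singleton.
Singletons are null because the dimension is positive. -/
lemma IsMorse.ae_gradSq_pos {d : ℕ} [NeZero d] {f : (Fin d → ℝ) → ℝ} (hf : IsMorse f) :
    ∀ᵐ p ∂(brillouinMeasure d), 0 < gradSq f p := by
  refine (brillouinMeasure_absolutelyContinuous d).ae_le ?_
  have h : (volume : Measure (Fin d → ℝ)) {p | gradSq f p = 0} = 0 := by
    refine measure_null_of_locally_null _ fun p hp => ⟨{p}, ?_, by simp⟩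
    obtain ⟨c, hc, hev⟩ := hf.exists_le_gradSq hp
    rw [mem_nhdsWithin_iff_eventually]
    filter_upwards [hev] with q hq hq0
    rw [hq0] at hq
    have : ‖q - p‖ ^ 2 ≤ 0 := by
      by_contra! h
      nlinarith [mul_pos hc h]
    have h0 : ‖q - p‖ = 0 := by nlinarith [norm_nonneg (q - p)]
    simpa [sub_eq_zero] using h0
  filter_upwards [compl_mem_ae_iff.2 h] with p hp
  exact lt_of_le_of_ne (gradSq_nonneg f p) (Ne.symm hp)

/-- In polar coordinates the radial integrand is `r ^ (d - 1 - 5/2)`, integrable at zero exactly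
when `d > 5/2`. This is the source of the dimension restriction. -/
lemma integrableAtFilter_norm_sub_rpow {d : ℕ} (hd : 3 ≤ d) (p : Fin d → ℝ) :
    IntegrableAtFilter (fun q : Fin d → ℝ => ‖q - p‖ ^ (-(5 / 2) : ℝ)) (nhds p) := by
  have : Nonempty (Fin d) := ⟨⟨0, by omega⟩⟩
  have h0 : IntegrableOn (fun x : Fin d → ℝ => ‖x‖ ^ (-(5 / 2) : ℝ)) (Metric.ball 0 1) := by
    rw [integrableOn_fun_norm_addHaar volume (f := fun r : ℝ => r ^ (-(5 / 2) : ℝ))]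
    have h1 : IntegrableOn (fun r : ℝ => r ^ ((d : ℝ) - 1 - 5 / 2)) (Set.Ioo 0 1) := by
      rw [intervalIntegral.integrableOn_Ioo_rpow_iff one_pos]
      have : (3 : ℝ) ≤ d := by exact_mod_cast hd
      linarith
    refine h1.congr_fun (fun r hr => ?_) measurableSet_Ioo
    simp only [smul_eq_mul, Module.finrank_fintype_fun_eq_card, Fintype.card_fin]
    rw [← Real.rpow_natCast, ← Real.rpow_add hr.1, Nat.cast_sub (by omega)]
    push_cast
    ring_nf
  refine ⟨Metric.ball p 1, Metric.ball_mem_nhds p one_pos, ?_⟩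
  have hmp : MeasurePreserving (fun q : Fin d → ℝ => q - p) volume volume :=
    measurePreserving_sub_right volume p
  have h2 := (hmp.integrableOn_comp_preimage (MeasurableEquiv.subRight p).measurableEmbedding
    (f := fun x : Fin d → ℝ => ‖x‖ ^ (-(5 / 2) : ℝ)) (s := Metric.ball 0 1)).2 h0
  have h3 : (fun q : Fin d → ℝ => q - p) ⁻¹' Metric.ball 0 1 = Metric.ball p 1 := by
    ext q; simp [dist_eq_norm]
  rwa [h3] at h2

/-- In dimension at least three, `|∇f|^(-5/2)` is integrable for every Morse function. -/
theorem IsMorse.integrable_gradSq_rpow {d : ℕ} (hd : 3 ≤ d) {f : (Fin d → ℝ) → ℝ}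
    (hf : IsMorse f) :
    Integrable (fun p => gradSq f p ^ (-(5 / 4) : ℝ)) (brillouinMeasure d) := by
  have hcont := continuous_gradSq (hf.1.of_le one_le_two)
  have hmeas : Measurable fun p => gradSq f p ^ (-(5 / 4) : ℝ) := hcont.measurable.pow_const _
  refine integrable_brillouin_of_locallyIntegrable fun p => ?_
  rcases (gradSq_nonneg f p).eq_or_lt with hp | hp
  · obtain ⟨c, hc, hev⟩ := hf.exists_le_gradSq hp.symm
    obtain ⟨s, hs, hint⟩ := integrableAtFilter_norm_sub_rpow hd p
    obtain ⟨t, hts, hto, hpt⟩ := mem_nhds_iff.1 (Filter.inter_mem hs hev)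
    refine ⟨t, hto.mem_nhds hpt, ?_⟩
    have hint' := (hint.mono_set fun q hq => (hts hq).1).const_mul (c ^ (-(5 / 4) : ℝ))
    refine Integrable.mono' hint' hmeas.aestronglyMeasurable ?_
    filter_upwards [ae_restrict_mem hto.measurableSet] with q hq
    have hle : c * ‖q - p‖ ^ 2 ≤ gradSq f q := (hts hq).2
    rw [Real.norm_of_nonneg (Real.rpow_nonneg (gradSq_nonneg f q) _)]
    -- At the critical point itself the convention `0 ^ (-5/4) = 0` makes the inequality trivial.
    rcases eq_or_ne q p with rfl | hqp
    · rw [← hp, Real.zero_rpow (by norm_num)]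
      positivity
    have hpos : 0 < ‖q - p‖ := norm_pos_iff.2 (sub_ne_zero.2 hqp)
    calc gradSq f q ^ (-(5 / 4) : ℝ) ≤ (c * ‖q - p‖ ^ 2) ^ (-(5 / 4) : ℝ) :=
          Real.rpow_le_rpow_of_nonpos (by positivity) hle (by norm_num)
      _ = c ^ (-(5 / 4) : ℝ) * ‖q - p‖ ^ (-(5 / 2) : ℝ) := by
        rw [Real.mul_rpow hc.le (by positivity), ← Real.rpow_natCast, ← Real.rpow_mul hpos.le]
        norm_num
  · have hc : ContinuousAt (fun p => gradSq f p ^ (-(5 / 4) : ℝ)) p :=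
      hcont.continuousAt.rpow_const (Or.inl hp.ne')
    exact hc.tendsto.integrableAtFilter ⟨Set.univ, Filter.univ_mem, hmeas.aestronglyMeasurable⟩
      (volume.finiteAt_nhds p)

/-- Follows from `u⁻¹ ≤ 1 + u ^ (-5/4)`, treating `u ≥ 1` and `u ≤ 1` separately. -/
lemma IsMorse.integrable_inv_gradSq {d : ℕ} (hd : 3 ≤ d) {f : (Fin d → ℝ) → ℝ}
    (hf : IsMorse f) : Integrable (fun p => (gradSq f p)⁻¹) (brillouinMeasure d) := by
  have hcont := continuous_gradSq (hf.1.of_le one_le_two)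
  refine ((integrable_const 1).add (hf.integrable_gradSq_rpow hd)).mono'
    hcont.measurable.inv.aestronglyMeasurable (Filter.Eventually.of_forall fun p => ?_)
  have h0 := gradSq_nonneg f p
  rw [Real.norm_of_nonneg (inv_nonneg.2 h0)]
  simp only [Pi.add_apply]
  rcases h0.eq_or_lt with h | h
  · rw [← h]; simp
  rcases le_total 1 (gradSq f p) with h1 | h1
  · exact (inv_le_one_of_one_le₀ h1).trans (le_add_of_nonneg_right (Real.rpow_nonneg h0 _))
  · refine le_add_of_nonneg_of_le zero_le_one ?_
    rw [← Real.rpow_neg_one]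
    exact Real.rpow_le_rpow_of_exponent_ge h h1 (by norm_num)

/-! ### Integration by parts along the gradient -/

section Calculus

variable {d : ℕ} {p : Fin d → ℝ}

lemma partialDeriv_mul {A : Type*} [NormedCommRing A] [NormedAlgebra ℝ A]
    {f g : (Fin d → ℝ) → A} (hf : DifferentiableAt ℝ f p) (hg : DifferentiableAt ℝ g p)
    (i : Fin d) :
    partialDeriv i (fun q => f q * g q) p = partialDeriv i f p * g p + f p * partialDeriv i g p := by
  unfold partialDeriv
  rw [fderiv_fun_mul hf hg]
  simp [mul_comm]
  ring

lemma partialDeriv_comp {E : Type*} [NormedAddCommGroup E] [NormedSpace ℝ E]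
    {f : (Fin d → ℝ) → ℝ} {Ψ : ℝ → E} (hΨ : DifferentiableAt ℝ Ψ (f p))
    (hf : DifferentiableAt ℝ f p) (i : Fin d) :
    partialDeriv i (fun q => Ψ (f q)) p = partialDeriv i f p • deriv Ψ (f p) := by
  unfold partialDeriv
  have h := (hΨ.hasFDerivAt.comp p hf.hasFDerivAt).fderiv
  change fderiv ℝ (Ψ ∘ f) p _ = _
  rw [h]
  exact fderiv_eq_smul_deriv _

lemma partialDeriv_ofReal {f : (Fin d → ℝ) → ℝ} (hf : DifferentiableAt ℝ f p) (i : Fin d) :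
    partialDeriv i (fun q => (f q : ℂ)) p = Complex.ofReal (partialDeriv i f p) := by
  unfold partialDeriv
  have h := (Complex.ofRealCLM.hasFDerivAt.comp p hf.hasFDerivAt).fderiv
  change fderiv ℝ (Complex.ofRealCLM ∘ f) p _ = _
  rw [h]
  simp

lemma partialDeriv_sum {E : Type*} [NormedAddCommGroup E] [NormedSpace ℝ E] {ι : Type*}
    {s : Finset ι} {f : ι → (Fin d → ℝ) → E} (hf : ∀ j ∈ s, DifferentiableAt ℝ (f j) p)
    (i : Fin d) :
    partialDeriv i (fun q => ∑ j ∈ s, f j q) p = ∑ j ∈ s, partialDeriv i (f j) p := by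
  unfold partialDeriv
  rw [fderiv_fun_sum hf]
  simp

end Calculus

/-- Integration by parts of `Ψ'(f) ∑ᵢ (∂ᵢf) Yᵢ` on the torus. -/
lemma integral_deriv_comp_mul_sum {d : ℕ} {f : (Fin d → ℝ) → ℝ} (hf : ContDiff ℝ 1 f)
    (hfper : TorusPeriodic f) {Ψ : ℝ → ℂ} (hΨ : ContDiff ℝ 1 Ψ) {Y : Fin d → (Fin d → ℝ) → ℂ}
    (hY : ∀ i, ContDiff ℝ 1 (Y i)) (hYper : ∀ i, TorusPeriodic (Y i)) :
    ∫ p, deriv Ψ (f p) * ∑ i, Complex.ofReal (partialDeriv i f p) * Y i p ∂(brillouinMeasure d)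
      = -∫ p, Ψ (f p) * ∑ i, partialDeriv i (Y i) p ∂(brillouinMeasure d) := by
  have hΨf : ContDiff ℝ 1 fun p => Ψ (f p) := hΨ.comp hf
  have hprod : ∀ i, ContDiff ℝ 1 fun p => Ψ (f p) * Y i p := fun i => hΨf.mul (hY i)
  have hzero : ∀ i, ∫ p, partialDeriv i (fun q => Ψ (f q) * Y i q) p ∂(brillouinMeasure d) = 0 :=
    fun i => integral_partialDeriv_eq_zero (hprod i)
      (fun p k => by simp only [hfper p k, hYper i p k]) i
  have hform : ∀ i p, partialDeriv i (fun q => Ψ (f q) * Y i q) p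
      = deriv Ψ (f p) * (Complex.ofReal (partialDeriv i f p) * Y i p) + Ψ (f p) * partialDeriv i (Y i) p := by
    intro i p
    rw [partialDeriv_mul (hΨf.differentiable one_ne_zero p) ((hY i).differentiable one_ne_zero p),
      partialDeriv_comp (hΨ.differentiable one_ne_zero _) (hf.differentiable one_ne_zero p),
      Complex.real_smul]
    ring
  have hsum : ∑ i, ∫ p, partialDeriv i (fun q => Ψ (f q) * Y i q) p ∂(brillouinMeasure d) = 0 :=
    Finset.sum_eq_zero fun i _ => hzero i
  rw [← integral_finsetSum _ fun i _ =>
    integrable_brillouin_of_continuous (continuous_partialDeriv (hprod i) i)] at hsum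
  have hc1 : Continuous fun p => deriv Ψ (f p) * ∑ i, Complex.ofReal (partialDeriv i f p) * Y i p := by
    refine ((hΨ.continuous_deriv le_rfl).comp hf.continuous).mul (continuous_finsetSum _ fun i _ => ?_)
    exact (Complex.continuous_ofReal.comp (continuous_partialDeriv hf i)).mul (hY i).continuous
  have hc2 : Continuous fun p => Ψ (f p) * ∑ i, partialDeriv i (Y i) p :=
    hΨf.continuous.mul (continuous_finsetSum _ fun i _ => continuous_partialDeriv (hY i) i)
  rw [eq_neg_iff_add_eq_zero, ← integral_add (integrable_brillouin_of_continuous hc1)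
    (integrable_brillouin_of_continuous hc2), ← hsum]
  refine integral_congr_ae (Filter.Eventually.of_forall fun p => ?_)
  simp only [hform, Finset.sum_add_distrib, Finset.mul_sum]

/-- `g` is a continuously differentiable function on the torus and `M` bounds `g` and its first
partial derivatives on the Brillouin zone. -/
structure C1Bound {d : ℕ} (g : (Fin d → ℝ) → ℂ) (M : ℝ) : Prop where
  contDiff : ContDiff ℝ 1 g
  periodic : TorusPeriodic g
  norm_le : ∀ p ∈ cube d, ‖g p‖ ≤ M
  norm_partialDeriv_le : ∀ p ∈ cube d, ∀ i, ‖partialDeriv i g p‖ ≤ M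

lemma zero_mem_cube (d : ℕ) : (0 : Fin d → ℝ) ∈ cube d :=
  ⟨fun _ => by simpa using Real.pi_pos.le, fun _ => Real.pi_pos.le⟩

lemma C1Bound.nonneg {d : ℕ} {g : (Fin d → ℝ) → ℂ} {M : ℝ} (h : C1Bound g M) : 0 ≤ M :=
  (norm_nonneg _).trans (h.norm_le 0 (zero_mem_cube d))

lemma C1Bound.one {d : ℕ} : C1Bound (fun _ : Fin d → ℝ => (1 : ℂ)) 1 where
  contDiff := contDiff_const
  periodic := fun _ _ => rfl
  norm_le := by simp
  norm_partialDeriv_le := by simp [partialDeriv]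

lemma exists_bound_on_cube {d : ℕ} {ι : Type*} [Finite ι] {E : Type*} [NormedAddCommGroup E]
    {f : ι → (Fin d → ℝ) → E} (hf : ∀ i, Continuous (f i)) :
    ∃ K : ℝ, 0 ≤ K ∧ ∀ i, ∀ p ∈ cube d, ‖f i p‖ ≤ K := by
  cases nonempty_fintype ι
  have h : ∀ i, ∃ K : ℝ, ∀ p ∈ cube d, ‖f i p‖ ≤ K := fun i =>
    isCompact_Icc.exists_bound_of_continuousOn (hf i).continuousOn
  choose K hK using h
  refine ⟨∑ i, |K i|, by positivity, fun i p hp => (hK i p hp).trans ((le_abs_self _).trans ?_)⟩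
  exact Finset.single_le_sum (f := fun i => |K i|) (fun _ _ => abs_nonneg _) (Finset.mem_univ i)

/-- The components of the vector field `∇f / (|∇f|² + δ)`. -/
noncomputable def regField {d : ℕ} (f : (Fin d → ℝ) → ℝ) (δ : ℝ) (i : Fin d) (p : Fin d → ℝ) : ℝ :=
  partialDeriv i f p * (gradSq f p + δ)⁻¹

lemma contDiff_regField {d : ℕ} {f : (Fin d → ℝ) → ℝ} (hf : ContDiff ℝ 2 f) {δ : ℝ} (hδ : 0 < δ)
    (i : Fin d) : ContDiff ℝ 1 (regField f δ i) :=
  (contDiff_partialDeriv hf (by norm_num) i).mul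
    (((contDiff_gradSq hf (by norm_num)).add contDiff_const).inv
      fun p => (add_pos_of_nonneg_of_pos (gradSq_nonneg f p) hδ).ne')

/-- Makes `∂ᵢf ∂ᵢ|∇f|²` of order `|∇f|²`, so that differentiating the denominator of `regField`
costs no more than one inverse power of `|∇f|²`. -/
lemma abs_mul_le_gradSq {d : ℕ} (f : (Fin d → ℝ) → ℝ) (p : Fin d → ℝ) (i j : Fin d) :
    |partialDeriv i f p| * |partialDeriv j f p| ≤ gradSq f p := by
  have h1 := partialDeriv_sq_le_gradSq f p i
  have h2 := partialDeriv_sq_le_gradSq f p j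
  rw [← sq_abs] at h1 h2
  nlinarith [sq_nonneg (|partialDeriv i f p| - |partialDeriv j f p|)]

lemma partialDeriv_gradSq {d : ℕ} {f : (Fin d → ℝ) → ℝ} (hf : ContDiff ℝ 2 f) (i : Fin d)
    (p : Fin d → ℝ) : partialDeriv i (gradSq f) p
      = ∑ j, 2 * (partialDeriv j f p * partialDeriv i (partialDeriv j f) p) := by
  have hd : ∀ j, DifferentiableAt ℝ (partialDeriv j f) p := fun j =>
    (contDiff_partialDeriv (m := 1) hf (by norm_num) j).differentiable one_ne_zero p
  change partialDeriv i (fun q => ∑ j, partialDeriv j f q ^ 2) p = _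
  rw [partialDeriv_sum (f := fun j q => partialDeriv j f q ^ 2) fun j _ => (hd j).pow 2]
  refine Finset.sum_congr rfl fun j _ => ?_
  simp only [pow_two]
  rw [partialDeriv_mul (hd j) (hd j)]
  ring

lemma partialDeriv_regField {d : ℕ} {f : (Fin d → ℝ) → ℝ} (hf : ContDiff ℝ 2 f) {δ : ℝ}
    (hδ : 0 < δ) (i : Fin d) (p : Fin d → ℝ) :
    partialDeriv i (regField f δ i) p = partialDeriv i (partialDeriv i f) p * (gradSq f p + δ)⁻¹
      - partialDeriv i f p * partialDeriv i (gradSq f) p * ((gradSq f p + δ)⁻¹) ^ 2 := by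
  have hpos : gradSq f p + δ ≠ 0 := (add_pos_of_nonneg_of_pos (gradSq_nonneg f p) hδ).ne'
  have h1 : DifferentiableAt ℝ (partialDeriv i f) p :=
    (contDiff_partialDeriv (m := 1) hf (by norm_num) i).differentiable one_ne_zero p
  have h2 : DifferentiableAt ℝ (gradSq f) p :=
    (contDiff_gradSq (m := 1) hf (by norm_num)).differentiable one_ne_zero p
  have h3 : HasDerivAt (fun s : ℝ => (s + δ)⁻¹) (-1 / (gradSq f p + δ) ^ 2) (gradSq f p) :=
    ((hasDerivAt_id _).add_const δ).fun_inv hpos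
  have h4 : DifferentiableAt ℝ (fun q => (gradSq f q + δ)⁻¹) p :=
    (h2.add_const δ).fun_inv hpos
  change partialDeriv i (fun q => partialDeriv i f q * (gradSq f q + δ)⁻¹) p = _
  rw [partialDeriv_mul h1 h4, partialDeriv_comp (Ψ := fun s : ℝ => (s + δ)⁻¹)
    h3.differentiableAt h2, h3.deriv, smul_eq_mul]
  field_simp
  ring

/-- A bound on the divergence of `g ∇f / (|∇f|² + δ)`, uniform in `δ`. -/
lemma exists_norm_div_regField_le {d : ℕ} {f : (Fin d → ℝ) → ℝ} (hf : ContDiff ℝ 2 f) :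
    ∃ C : ℝ, 0 ≤ C ∧ ∀ (g : (Fin d → ℝ) → ℂ) (M : ℝ), C1Bound g M → ∀ δ > 0, ∀ p ∈ cube d,
      0 < gradSq f p →
      ‖∑ i, partialDeriv i (fun q => g q * (regField f δ i q : ℂ)) p‖
        ≤ C * M * (gradSq f p)⁻¹ := by
  obtain ⟨K₁, hK₁, hb₁⟩ := exists_bound_on_cube (f := fun i : Fin d => partialDeriv i f)
    fun i => continuous_partialDeriv (hf.of_le one_le_two) i
  obtain ⟨K₂, hK₂, hb₂⟩ := exists_bound_on_cube
    (f := fun ij : Fin d × Fin d => partialDeriv ij.1 (partialDeriv ij.2 f))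
    fun ij => continuous_partialDeriv (contDiff_partialDeriv hf (by norm_num) _) _
  -- For each of the `d` directions: `K₁` comes from the derivative hitting `g`, `K₂` from hitting
  -- `∂ᵢf`, and `2 d K₂` from hitting the denominator.
  refine ⟨d * (K₁ + (K₂ + 2 * d * K₂)), by positivity, fun g M hg δ hδ p hp hpos => ?_⟩
  have hM := hg.nonneg
  set u := gradSq f p with hu
  have hinv : (u + δ)⁻¹ ≤ u⁻¹ := inv_anti₀ hpos (by linarith)
  have hinv0 : 0 ≤ (u + δ)⁻¹ := by positivity
  have hX : ∀ i, |regField f δ i p| ≤ K₁ * u⁻¹ := fun i => by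
    rw [regField, abs_mul, abs_of_nonneg hinv0]
    exact mul_le_mul (hb₁ i p hp) hinv hinv0 hK₁
  have hfu : ∀ i, |partialDeriv i f p * partialDeriv i (gradSq f) p| ≤ 2 * d * K₂ * u := fun i => by
    rw [partialDeriv_gradSq hf, Finset.mul_sum]
    refine (Finset.abs_sum_le_sum_abs _ _).trans ?_
    refine (Finset.sum_le_card_nsmul _ _ (2 * K₂ * u) fun j _ => ?_).trans (le_of_eq ?_)
    · have h1 := abs_mul_le_gradSq f p i j
      have h2 : |partialDeriv i (partialDeriv j f) p| ≤ K₂ := hb₂ (i, j) p hp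
      calc |partialDeriv i f p * (2 * (partialDeriv j f p * partialDeriv i (partialDeriv j f) p))|
          = 2 * (|partialDeriv i f p| * |partialDeriv j f p|)
              * |partialDeriv i (partialDeriv j f) p| := by
            simp only [abs_mul, abs_two]; ring
        _ ≤ 2 * u * K₂ := by gcongr
        _ = _ := by ring
    · simp; ring
  have hX' : ∀ i, |partialDeriv i (regField f δ i) p| ≤ (K₂ + 2 * d * K₂) * u⁻¹ := fun i => by
    rw [partialDeriv_regField hf hδ]
    refine (abs_sub _ _).trans ?_
    rw [add_mul]
    refine add_le_add ?_ ?_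
    · rw [abs_mul, abs_of_nonneg hinv0]
      exact mul_le_mul (hb₂ (i, i) p hp) hinv hinv0 hK₂
    · rw [abs_mul, abs_of_nonneg (sq_nonneg (u + δ)⁻¹)]
      calc _ ≤ 2 * d * K₂ * u * (u⁻¹) ^ 2 := by
            gcongr
            exact hfu i
        _ = _ := by field_simp
  have hgd : DifferentiableAt ℝ g p := hg.contDiff.differentiable one_ne_zero p
  have hXd : ∀ i, DifferentiableAt ℝ (regField f δ i) p := fun i =>
    (contDiff_regField hf hδ i).differentiable one_ne_zero p
  refine (norm_sum_le _ _).trans ?_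
  refine (Finset.sum_le_card_nsmul _ _ ((K₁ + (K₂ + 2 * d * K₂)) * M * u⁻¹)
    fun i _ => ?_).trans (le_of_eq ?_)
  · rw [partialDeriv_mul (g := fun q => (regField f δ i q : ℂ)) hgd
        (Complex.ofRealCLM.differentiableAt.comp p (hXd i)),
      partialDeriv_ofReal (hXd i)]
    refine (norm_add_le _ _).trans ?_
    rw [norm_mul, norm_mul, Complex.norm_real, Complex.norm_real, Real.norm_eq_abs,
      Real.norm_eq_abs]
    calc _ ≤ M * (K₁ * u⁻¹) + M * ((K₂ + 2 * d * K₂) * u⁻¹) :=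
          add_le_add (mul_le_mul (hg.norm_partialDeriv_le p hp i) (hX i) (abs_nonneg _) hM)
            (mul_le_mul (hg.norm_le p hp) (hX' i) (abs_nonneg _) hM)
      _ = _ := by ring
  · simp; ring

/-- The basic estimate on `∫ Ψ'(f) g`, obtained by integrating by parts along `∇f / |∇f|²`. -/
theorem IsMorse.exists_norm_integral_deriv_comp_mul_le {d : ℕ} (hd : 3 ≤ d)
    {f : (Fin d → ℝ) → ℝ} (hf : IsMorse f) (hper : TorusPeriodic f) :
    ∃ C : ℝ, 0 ≤ C ∧ ∀ (Ψ : ℝ → ℂ), ContDiff ℝ 1 Ψ → ∀ (g : (Fin d → ℝ) → ℂ) (M : ℝ),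
      C1Bound g M →
      ‖∫ p, deriv Ψ (f p) * g p ∂(brillouinMeasure d)‖
        ≤ C * M * ∫ p, ‖Ψ (f p)‖ * (gradSq f p)⁻¹ ∂(brillouinMeasure d) := by
  have : NeZero d := ⟨by omega⟩
  have hf1 : ContDiff ℝ 1 f := hf.1.of_le one_le_two
  obtain ⟨C, hC, hdiv⟩ := exists_norm_div_regField_le hf.1
  refine ⟨C, hC, fun Ψ hΨ g M hg => ?_⟩
  have hM := hg.nonneg
  have hg1 := hg.contDiff
  have hcf : Continuous fun p => deriv Ψ (f p) * g p :=
    ((hΨ.continuous_deriv le_rfl).comp hf1.continuous).mul hg1.continuous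
  have hΨf : Continuous fun p => Ψ (f p) := hΨ.continuous.comp hf1.continuous
  have hmaj : Integrable (fun p => ‖Ψ (f p)‖ * (gradSq f p)⁻¹) (brillouinMeasure d) := by
    obtain ⟨K, -, hK⟩ := exists_bound_on_cube (ι := Unit) (f := fun _ p => Ψ (f p)) fun _ => hΨf
    refine Integrable.bdd_mul (hf.integrable_inv_gradSq hd) hΨf.norm.aestronglyMeasurable
      (c := K) ?_
    filter_upwards [ae_mem_closedCube d] with p hp
    simpa using hK () p hp
  -- The field `∇f / |∇f|²` is singular at critical points, so `δ > 0` is inserted to make it C¹.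
  -- Pairing `regField` with `∇f` then gives `|∇f|² / (|∇f|² + δ)` instead of `1`, and the resulting
  -- bound does not depend on `δ`.
  have hstep : ∀ δ > 0, ‖∫ p, deriv Ψ (f p) * g p * ((gradSq f p / (gradSq f p + δ) : ℝ) : ℂ)
      ∂(brillouinMeasure d)‖
        ≤ C * M * ∫ p, ‖Ψ (f p)‖ * (gradSq f p)⁻¹ ∂(brillouinMeasure d) := by
    intro δ hδ
    have hY : ∀ i, ContDiff ℝ 1 fun q => g q * (regField f δ i q : ℂ) := fun i =>
      hg1.mul (Complex.ofRealCLM.contDiff.comp (contDiff_regField hf.1 hδ i))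
    have hYper : ∀ i, TorusPeriodic fun q => g q * (regField f δ i q : ℂ) := fun i p k => by
      simp only [regField, hg.periodic p k, hper.gradSq p k, hper.partialDeriv i p k]
    have hibp := integral_deriv_comp_mul_sum hf1 hper hΨ hY hYper
    have heq : ∀ p, deriv Ψ (f p) * g p * ((gradSq f p / (gradSq f p + δ) : ℝ) : ℂ)
        = deriv Ψ (f p) * ∑ i, Complex.ofReal (partialDeriv i f p) * (g p * (regField f δ i p : ℂ)) := by
      intro p
      have : gradSq f p / (gradSq f p + δ) = ∑ i, partialDeriv i f p * regField f δ i p := by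
        simp only [regField, ← mul_assoc, ← Finset.sum_mul, ← pow_two]
        rfl
      rw [this, mul_assoc]
      push_cast
      rw [Finset.mul_sum]
      congr 1
      exact Finset.sum_congr rfl fun i _ => by ring
    simp_rw [heq]
    rw [hibp, norm_neg, ← integral_const_mul]
    refine norm_integral_le_of_norm_le (hmaj.const_mul _) ?_
    filter_upwards [ae_mem_closedCube d, hf.ae_gradSq_pos] with p hp hpos
    rw [norm_mul]
    calc _ ≤ ‖Ψ (f p)‖ * (C * M * (gradSq f p)⁻¹) := by
          gcongr
          exact hdiv g M hg δ hδ p hp hpos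
      _ = _ := by ring
  -- Removing the regularization along `δ = 1 / (n + 1)`: the extra factor lies in `[0, 1]` and
  -- tends to `1` off the null set of critical points.
  have hlim : Filter.Tendsto (fun n : ℕ => ∫ p, deriv Ψ (f p) * g p *
      ((gradSq f p / (gradSq f p + 1 / ((n : ℝ) + 1)) : ℝ) : ℂ) ∂(brillouinMeasure d))
      Filter.atTop (nhds (∫ p, deriv Ψ (f p) * g p ∂(brillouinMeasure d))) := by
    refine tendsto_integral_of_dominated_convergence (fun p => ‖deriv Ψ (f p) * g p‖)
      (fun n => ?_) (integrable_brillouin_of_continuous hcf.norm) (fun n => ?_) ?_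
    · refine (hcf.mul (Complex.continuous_ofReal.comp ?_)).aestronglyMeasurable
      refine (continuous_gradSq hf1).div ((continuous_gradSq hf1).add continuous_const) fun p => ?_
      have := gradSq_nonneg f p
      positivity
    · refine Filter.Eventually.of_forall fun p => ?_
      have h0 := gradSq_nonneg f p
      rw [norm_mul, Complex.norm_real, Real.norm_of_nonneg (by positivity)]
      refine mul_le_of_le_one_right (norm_nonneg _) (div_le_one_of_le₀ ?_ (by positivity))
      exact le_add_of_nonneg_right (by positivity)
    · filter_upwards [hf.ae_gradSq_pos] with p hpos
      have h1 : Filter.Tendsto (fun n : ℕ => gradSq f p / (gradSq f p + 1 / ((n : ℝ) + 1)))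
          Filter.atTop (nhds (gradSq f p / (gradSq f p + 0))) :=
        tendsto_const_nhds.div (tendsto_const_nhds.add tendsto_one_div_add_atTop_nhds_zero_nat)
          (by simpa using hpos.ne')
      rw [add_zero, div_self hpos.ne'] at h1
      simpa using (tendsto_const_nhds (x := deriv Ψ (f p) * g p)).mul
        ((Complex.continuous_ofReal.tendsto 1).comp h1)
  exact le_of_tendsto hlim.norm (Filter.Eventually.of_forall fun n => hstep _ (by positivity))

/-! ### Uniform bounds on singular integrals -/

/-- A primitive, up to a factor, of `s ↦ |z - s|^(-1/2)`. -/
noncomputable def rootPrimitive (z : ℂ) (s : ℝ) : ℝ :=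
  (s - z.re) * ((s - z.re) ^ 2 + z.im ^ 2) ^ (-(1 / 4) : ℝ)

lemma norm_sub_ofReal_sq (z : ℂ) (s : ℝ) : ‖z - s‖ ^ 2 = (s - z.re) ^ 2 + z.im ^ 2 := by
  rw [← Complex.normSq_eq_norm_sq, Complex.normSq_apply]
  simp
  ring

lemma sub_ofReal_ne_zero {z : ℂ} (hz : z.im ≠ 0) (s : ℝ) : z - s ≠ 0 := fun h => by
  apply hz
  simpa using congrArg Complex.im h

lemma norm_sub_ofReal_rpow (z : ℂ) (s : ℝ) :
    ((s - z.re) ^ 2 + z.im ^ 2) ^ (-(1 / 4) : ℝ) = ‖z - s‖ ^ (-(1 / 2) : ℝ) := by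
  rw [← norm_sub_ofReal_sq, ← Real.rpow_natCast, ← Real.rpow_mul (norm_nonneg _)]
  norm_num

lemma contDiff_rootPrimitive {z : ℂ} (hz : z.im ≠ 0) : ContDiff ℝ 1 (rootPrimitive z) := by
  unfold rootPrimitive
  refine ContDiff.mul (by fun_prop) (ContDiff.rpow_const_of_ne (by fun_prop) fun s => ?_)
  positivity

/-- With `q = |z - s|²` the derivative equals `q ^ (-1/4) (1 - (s - Re z)² / (2q))`, and the
subtracted fraction is at most `1/2`. -/
lemma le_deriv_rootPrimitive {z : ℂ} (hz : z.im ≠ 0) (s : ℝ) :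
    ‖z - s‖ ^ (-(1 / 2) : ℝ) ≤ 2 * deriv (rootPrimitive z) s := by
  have hq : 0 < (s - z.re) ^ 2 + z.im ^ 2 := by positivity
  have h1 : HasDerivAt (fun s : ℝ => s - z.re) 1 s := (hasDerivAt_id s).sub_const _
  have h2 : HasDerivAt (fun s : ℝ => (s - z.re) ^ 2 + z.im ^ 2) (2 * (s - z.re)) s := by
    simpa using (h1.fun_pow 2).add_const (z.im ^ 2)
  have h3 := h1.mul (h2.rpow_const (p := (-(1 / 4) : ℝ)) (Or.inl hq.ne'))
  have h4 : deriv (rootPrimitive z) s = _ := h3.deriv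
  rw [h4, ← norm_sub_ofReal_rpow, Real.rpow_sub_one hq.ne']
  set q := (s - z.re) ^ 2 + z.im ^ 2 with hqd
  have h5 : 0 < q ^ (-(1 / 4) : ℝ) := Real.rpow_pos_of_pos hq _
  have h6 : (s - z.re) ^ 2 / q ≤ 1 := div_le_one_of_le₀ (by rw [hqd]; nlinarith) hq.le
  have h7 : 2 * (1 * q ^ (-(1 / 4) : ℝ)
      + (s - z.re) * (2 * (s - z.re) * -(1 / 4) * (q ^ (-(1 / 4) : ℝ) / q)))
      = q ^ (-(1 / 4) : ℝ) * (2 - (s - z.re) ^ 2 / q) := by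
    field_simp
    ring
  rw [h7]
  nlinarith

/-- The primitive is at most `|z - s| ^ (1/2)` in absolute value, so it stays bounded as `z`
approaches the real axis. -/
lemma abs_rootPrimitive_le {z : ℂ} (hz : z.im ≠ 0) (s : ℝ) :
    |rootPrimitive z s| ≤ 1 + ‖z - s‖ := by
  have hpos : 0 < ‖z - s‖ := norm_pos_iff.2 (sub_ofReal_ne_zero hz s)
  rw [rootPrimitive, norm_sub_ofReal_rpow, abs_mul, abs_of_pos (Real.rpow_pos_of_pos hpos _)]
  have h1 : |s - z.re| ≤ ‖z - s‖ := by
    have := Complex.abs_re_le_norm (z - s)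
    rwa [Complex.sub_re, Complex.ofReal_re, abs_sub_comm] at this
  calc |s - z.re| * ‖z - s‖ ^ (-(1 / 2) : ℝ) ≤ ‖z - s‖ * ‖z - s‖ ^ (-(1 / 2) : ℝ) := by gcongr
    _ = ‖z - s‖ ^ (1 / 2 : ℝ) := by
      conv_lhs => enter [1]; rw [← Real.rpow_one ‖z - s‖]
      rw [← Real.rpow_add hpos]; norm_num
    _ ≤ 1 + ‖z - s‖ := by
      rcases le_total ‖z - s‖ 1 with h | h
      · have := Real.rpow_le_one hpos.le h (by norm_num : (0 : ℝ) ≤ 1 / 2)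
        linarith
      · have := Real.rpow_le_rpow_of_exponent_le h (by norm_num : (1 / 2 : ℝ) ≤ 1)
        rw [Real.rpow_one] at this
        linarith

lemma continuous_norm_sub_rpow {d : ℕ} {f : (Fin d → ℝ) → ℝ} (hf : Continuous f) {z : ℂ}
    (hz : z.im ≠ 0) : Continuous fun p => ‖z - f p‖ ^ (-(1 / 2) : ℝ) := by
  refine Continuous.rpow_const (by fun_prop) fun p => Or.inl ?_
  exact norm_ne_zero_iff.2 (sub_ofReal_ne_zero hz _)

/-- Integration by parts with `g = 1` and `Ψ = rootPrimitive z`. As this primitive is at most `1 +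
R` on the range of `f`, only the integrability of `|∇f|⁻²` is needed, and no singularity in `z` is
left. -/
theorem IsMorse.exists_integral_norm_sub_rpow_le {d : ℕ} (hd : 3 ≤ d) {f : (Fin d → ℝ) → ℝ}
    (hf : IsMorse f) (hper : TorusPeriodic f) (R : ℝ) :
    ∃ C : ℝ, ∀ z : ℂ, z.im ≠ 0 → (∀ p ∈ cube d, ‖z - f p‖ ≤ R) →
      ∫ p, ‖z - f p‖ ^ (-(1 / 2) : ℝ) ∂(brillouinMeasure d) ≤ C := by
  obtain ⟨C, hC, h⟩ := hf.exists_norm_integral_deriv_comp_mul_le hd hper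
  refine ⟨2 * (C * 1 * ∫ p, (1 + R) * (gradSq f p)⁻¹ ∂(brillouinMeasure d)), fun z hz hR => ?_⟩
  have hΨ := contDiff_rootPrimitive hz
  have hf1 : ContDiff ℝ 1 f := hf.1.of_le one_le_two
  have hR0 : 0 ≤ R := (norm_nonneg _).trans (hR 0 (zero_mem_cube d))
  have hbound : ∀ᵐ p ∂(brillouinMeasure d), ‖((rootPrimitive z (f p) : ℝ) : ℂ)‖ ≤ 1 + R := by
    filter_upwards [ae_mem_closedCube d] with p hp
    rw [Complex.norm_real]
    exact (abs_rootPrimitive_le hz _).trans (by linarith [hR p hp])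
  have hderiv : ∀ s, deriv (fun s => (rootPrimitive z s : ℂ)) s = Complex.ofReal (deriv (rootPrimitive z) s) :=
    fun s => ((hΨ.differentiable one_ne_zero s).hasDerivAt.ofReal_comp).deriv
  have key := h (fun s => (rootPrimitive z s : ℂ)) (Complex.ofRealCLM.contDiff.comp hΨ) _ 1
    C1Bound.one
  simp only [hderiv, mul_one] at key
  rw [integral_complex_ofReal, Complex.norm_real] at key
  have hcd : Continuous fun p => deriv (rootPrimitive z) (f p) :=
    (hΨ.continuous_deriv le_rfl).comp hf1.continuous
  calc ∫ p, ‖z - f p‖ ^ (-(1 / 2) : ℝ) ∂(brillouinMeasure d)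
      ≤ ∫ p, 2 * deriv (rootPrimitive z) (f p) ∂(brillouinMeasure d) :=
        integral_mono (integrable_brillouin_of_continuous
          (continuous_norm_sub_rpow hf1.continuous hz))
          (integrable_brillouin_of_continuous (hcd.const_mul 2))
          fun p => le_deriv_rootPrimitive hz (f p)
    _ ≤ 2 * (C * ∫ p, ‖((rootPrimitive z (f p) : ℝ) : ℂ)‖ * (gradSq f p)⁻¹
          ∂(brillouinMeasure d)) := by
        rw [integral_const_mul]
        exact mul_le_mul_of_nonneg_left ((le_abs_self _).trans key) two_pos.le
    _ ≤ _ := by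
        rw [mul_one]
        refine mul_le_mul_of_nonneg_left (mul_le_mul_of_nonneg_left ?_ hC) two_pos.le
        refine integral_mono_of_nonneg (Filter.Eventually.of_forall fun p =>
          mul_nonneg (norm_nonneg _) (inv_nonneg.2 (gradSq_nonneg f p)))
          ((hf.integrable_inv_gradSq hd).const_mul _) ?_
        filter_upwards [hbound] with p hp
        exact mul_le_mul_of_nonneg_right hp (inv_nonneg.2 (gradSq_nonneg f p))

/-- The small exponent `1/10` is chosen so that its fifth power in Young's inequality produces `|w|
^ (-1/2)`. The argument of the logarithm contributes at most `π`, and `R` covers `|w| ≥ 1`. -/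
lemma norm_log_le {w : ℂ} (hw : w ≠ 0) {R : ℝ} (hR : ‖w‖ ≤ R) :
    ‖Complex.log w‖ ≤ 10 * ‖w‖ ^ (-(1 / 10) : ℝ) + (R + Real.pi) := by
  have hpos : 0 < ‖w‖ := norm_pos_iff.2 hw
  have h1 : ‖Complex.log w‖ ≤ |Real.log ‖w‖| + Real.pi := by
    refine (Complex.norm_le_abs_re_add_abs_im _).trans ?_
    rw [Complex.log_re, Complex.log_im]
    exact add_le_add_right (Complex.abs_arg_le_pi w) _
  have h2 : |Real.log ‖w‖| ≤ 10 * ‖w‖ ^ (-(1 / 10) : ℝ) + R := by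
    have h3 : 0 < ‖w‖ ^ (-(1 / 10) : ℝ) := Real.rpow_pos_of_pos hpos _
    refine abs_le.2 ⟨?_, ?_⟩
    · have h4 := Real.log_le_rpow_div (inv_nonneg.2 hpos.le) (by norm_num : (0 : ℝ) < 1 / 10)
      rw [Real.log_inv, Real.inv_rpow hpos.le, ← Real.rpow_neg hpos.le] at h4
      linarith
    · have := Real.log_le_sub_one_of_pos hpos
      linarith
  linarith

/-- Young's inequality with conjugate exponents `5` and `5/4`, matching the two integrals known to
be finite. -/
lemma rpow_mul_inv_le {t u : ℝ} (ht : 0 < t) (hu : 0 < u) :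
    t ^ (-(1 / 10) : ℝ) * u⁻¹ ≤ t ^ (-(1 / 2) : ℝ) + u ^ (-(5 / 4) : ℝ) := by
  have h := Real.young_inequality_of_nonneg (a := t ^ (-(1 / 10) : ℝ)) (b := u⁻¹) (p := 5)
    (q := 5 / 4) (by positivity) (by positivity) (by
      rw [Real.holderConjugate_iff]; norm_num)
  rw [← Real.rpow_mul ht.le, Real.inv_rpow hu.le, ← Real.rpow_neg hu.le] at h
  have h1 : 0 < t ^ (-(1 / 2) : ℝ) := Real.rpow_pos_of_pos ht _
  have h2 : 0 < u ^ (-(5 / 4) : ℝ) := Real.rpow_pos_of_pos hu _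
  norm_num at h h1 h2 ⊢
  linarith

/-- The uniform bound on `∫ g / (z - f)` for a Morse function `f` in dimension at least three. -/
theorem IsMorse.exists_norm_integral_div_le {d : ℕ} (hd : 3 ≤ d) {f : (Fin d → ℝ) → ℝ}
    (hf : IsMorse f) (hper : TorusPeriodic f) :
    ∃ C : ℝ, 0 ≤ C ∧ ∀ z : ℂ, z.im ≠ 0 → ∀ (g : (Fin d → ℝ) → ℂ) (M : ℝ), C1Bound g M →
      ‖∫ p, (z - f p)⁻¹ * g p ∂(brillouinMeasure d)‖ ≤ C * M := by
  have : NeZero d := ⟨by omega⟩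
  have hf1 : ContDiff ℝ 1 f := hf.1.of_le one_le_two
  obtain ⟨K, hK0, hK⟩ := exists_bound_on_cube (ι := Unit) (f := fun _ => f) fun _ => hf1.continuous
  set R : ℝ := K + 1 + K with hRdef
  obtain ⟨C₁, hC₁⟩ := hf.exists_integral_norm_sub_rpow_le hd hper R
  obtain ⟨C₂, hC₂, hibp⟩ := hf.exists_norm_integral_deriv_comp_mul_le hd hper
  have hI₂ := hf.integrable_gradSq_rpow hd
  have hI₁ := hf.integrable_inv_gradSq hd
  set D : ℝ := 10 * (|C₁| + ∫ p, gradSq f p ^ (-(5 / 4) : ℝ) ∂(brillouinMeasure d))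
    + (R + Real.pi) * ∫ p, (gradSq f p)⁻¹ ∂(brillouinMeasure d) with hD
  have hJ₂ : 0 ≤ ∫ p, gradSq f p ^ (-(5 / 4) : ℝ) ∂(brillouinMeasure d) :=
    integral_nonneg fun p => Real.rpow_nonneg (gradSq_nonneg f p) _
  have hJ₁ : 0 ≤ ∫ p, (gradSq f p)⁻¹ ∂(brillouinMeasure d) :=
    integral_nonneg fun p => inv_nonneg.2 (gradSq_nonneg f p)
  have hR0 : 0 ≤ R := by positivity
  have hD0 : 0 ≤ D := by
    have := Real.pi_pos
    positivity
  refine ⟨C₂ * D + 1, by positivity, fun z hz g M hg => ?_⟩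
  have hM := hg.nonneg
  -- Bounded `z` needs the logarithmic estimate, with `|z - f| ≤ R`. Otherwise `|z - f| ≥ 1` and the
  -- integrand is at most `M`; the summand `+ 1` in the constant is for this case.
  by_cases hzR : ‖z‖ ≤ K + 1
  · have hzf : ∀ p ∈ cube d, ‖z - f p‖ ≤ R := fun p hp => by
      refine (norm_sub_le _ _).trans ?_
      rw [Complex.norm_real]
      exact add_le_add hzR (hK () p hp)
    -- As `Im z ≠ 0`, the path `s ↦ z - s` never meets the branch cut of the logarithm.
    have hslit : ∀ s : ℝ, z - s ∈ Complex.slitPlane := fun s => Or.inr (by simpa using hz)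
    have hΨd : ∀ s : ℝ, HasDerivAt (fun s : ℝ => -Complex.log (z - s)) ((z - s)⁻¹) s := fun s => by
      have h1 : HasDerivAt (fun s : ℝ => z - (s : ℂ)) (-1) s := by
        simpa using (Complex.ofRealCLM.hasDerivAt (x := s)).const_sub z
      have h2 := (h1.clog_real (hslit s)).neg
      rw [neg_div, neg_neg, one_div] at h2
      exact h2
    have hΨ : ContDiff ℝ 1 fun s : ℝ => -Complex.log (z - s) := by
      rw [contDiff_one_iff_deriv]
      refine ⟨fun s => (hΨd s).differentiableAt, ?_⟩
      rw [show deriv (fun s : ℝ => -Complex.log (z - s)) = fun s : ℝ => (z - s)⁻¹ from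
        funext fun s => (hΨd s).deriv]
      exact Continuous.inv₀ (by fun_prop) fun s => sub_ofReal_ne_zero hz s
    have key := hibp _ hΨ g M hg
    simp only [(hΨd _).deriv, norm_neg] at key
    have hI₃ := integrable_brillouin_of_continuous (continuous_norm_sub_rpow hf1.continuous hz)
    have hI₄ : Integrable (fun p => 10 * (‖z - f p‖ ^ (-(1 / 2) : ℝ)
        + gradSq f p ^ (-(5 / 4) : ℝ))) (brillouinMeasure d) := (hI₃.add hI₂).const_mul 10
    have hI₅ : Integrable (fun p => (R + Real.pi) * (gradSq f p)⁻¹) (brillouinMeasure d) :=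
      hI₁.const_mul _
    have hle : ∫ p, ‖Complex.log (z - f p)‖ * (gradSq f p)⁻¹ ∂(brillouinMeasure d) ≤ D := by
      calc _ ≤ ∫ p, 10 * (‖z - f p‖ ^ (-(1 / 2) : ℝ) + gradSq f p ^ (-(5 / 4) : ℝ))
            + (R + Real.pi) * (gradSq f p)⁻¹ ∂(brillouinMeasure d) := by
            refine integral_mono_of_nonneg (Filter.Eventually.of_forall fun p =>
              mul_nonneg (norm_nonneg _) (inv_nonneg.2 (gradSq_nonneg f p))) (hI₄.add hI₅) ?_
            filter_upwards [ae_mem_closedCube d, hf.ae_gradSq_pos] with p hp hpos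
            have hw := sub_ofReal_ne_zero hz (f p)
            have h1 := norm_log_le hw (hzf p hp)
            have h2 := rpow_mul_inv_le (norm_pos_iff.2 hw) hpos
            calc _ ≤ (10 * ‖z - f p‖ ^ (-(1 / 10) : ℝ) + (R + Real.pi)) * (gradSq f p)⁻¹ := by
                  gcongr
              _ = 10 * (‖z - f p‖ ^ (-(1 / 10) : ℝ) * (gradSq f p)⁻¹)
                    + (R + Real.pi) * (gradSq f p)⁻¹ := by ring
              _ ≤ _ := by gcongr
        _ ≤ D := by
            rw [integral_add hI₄ hI₅, integral_const_mul, integral_const_mul,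
              integral_add hI₃ hI₂]
            have := (hC₁ z hz hzf).trans (le_abs_self C₁)
            rw [hD]
            gcongr
    calc _ ≤ C₂ * M * ∫ p, ‖Complex.log (z - f p)‖ * (gradSq f p)⁻¹ ∂(brillouinMeasure d) := key
      _ ≤ C₂ * M * D := by gcongr
      _ ≤ (C₂ * D + 1) * M := by nlinarith
  · push Not at hzR
    have h1 : ‖∫ p, (z - f p)⁻¹ * g p ∂(brillouinMeasure d)‖
        ≤ M * (brillouinMeasure d).real Set.univ := by
      refine norm_integral_le_of_norm_le_const ?_
      filter_upwards [ae_mem_closedCube d] with p hp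
      have h2 : 1 ≤ ‖z - f p‖ := by
        have h3 := norm_sub_norm_le z (f p : ℂ)
        have h4 := hK () p hp
        rw [Complex.norm_real] at h3
        linarith
      rw [norm_mul, norm_inv]
      calc _ ≤ 1 * M := mul_le_mul (inv_le_one_of_one_le₀ h2) (hg.norm_le p hp) (norm_nonneg _)
            zero_le_one
        _ = M := one_mul M
    rw [probReal_univ, mul_one] at h1
    have : 0 ≤ C₂ * D * M := by positivity
    linarith [add_mul (C₂ * D) 1 M]

/-! ### Multiplication operators and their resolvents -/

/-- The Fourier transform of a function on the torus. -/
noncomputable def fourierVec {d : ℕ} (g : (Fin d → ℝ) → ℂ) : SeqSpace d :=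
  latticeFourier d (toMomentum g)

lemma coeFn_toMomentum {d : ℕ} {g : (Fin d → ℝ) → ℂ} (hg : Continuous g) :
    toMomentum g =ᵐ[brillouinMeasure d] g := by
  rw [toMomentum, dif_pos (memLp_of_continuous hg 2)]
  exact MemLp.coeFn_toLp _

lemma coeFn_multiplication {d : ℕ} {f : (Fin d → ℝ) → ℂ} (hf : Continuous f)
    (g : MomentumSpace d) :
    multiplication f g =ᵐ[brillouinMeasure d] fun p => f p * g p := by
  have hm := memLp_of_continuous hf ⊤
  rw [multiplication, dif_pos hm]
  have h := (ContinuousLinearMap.mul ℂ ℂ).coeFn_holder (r := 2) (hm.toLp f) g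
  filter_upwards [h, hm.coeFn_toLp] with p h1 h2
  exact h1.trans (by rw [h2]; rfl)

lemma multiplication_toMomentum {d : ℕ} {f g : (Fin d → ℝ) → ℂ} (hf : Continuous f)
    (hg : Continuous g) :
    multiplication f (toMomentum g) = toMomentum fun p => f p * g p := by
  refine Lp.ext ?_
  filter_upwards [coeFn_multiplication hf (toMomentum g), coeFn_toMomentum hg,
    coeFn_toMomentum (hf.fun_mul hg)] with p h1 h2 h3
  rw [h1, h2, h3]

lemma toMomentum_sub {d : ℕ} {f g : (Fin d → ℝ) → ℂ} (hf : Continuous f) (hg : Continuous g) :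
    toMomentum (fun p => f p - g p) = toMomentum f - toMomentum g := by
  refine Lp.ext ?_
  filter_upwards [coeFn_toMomentum hf, coeFn_toMomentum hg, coeFn_toMomentum (hf.fun_sub hg),
    Lp.coeFn_sub (toMomentum f) (toMomentum g)] with p h1 h2 h3 h4
  rw [h3, h4, Pi.sub_apply, h1, h2]

lemma toMomentum_const_mul {d : ℕ} {f : (Fin d → ℝ) → ℂ} (hf : Continuous f) (c : ℂ) :
    toMomentum (fun p => c * f p) = c • toMomentum f := by
  refine Lp.ext ?_
  filter_upwards [coeFn_toMomentum hf, coeFn_toMomentum (hf.const_mul c),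
    Lp.coeFn_smul c (toMomentum f)] with p h1 h3 h4
  rw [h3, h4, Pi.smul_apply, h1, smul_eq_mul]

lemma inner_fourierVec {d : ℕ} {f g : (Fin d → ℝ) → ℂ} (hf : Continuous f) (hg : Continuous g) :
    ⟪fourierVec f, fourierVec g⟫_ℂ
      = ∫ p, (starRingEnd ℂ) (f p) * g p ∂(brillouinMeasure d) := by
  rw [fourierVec, fourierVec, LinearIsometryEquiv.inner_map_map, L2.inner_def]
  refine integral_congr_ae ?_
  filter_upwards [coeFn_toMomentum hf, coeFn_toMomentum hg] with p h1 h2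
  rw [h1, h2, RCLike.inner_apply, mul_comm]

lemma norm_fourierVec_le {d : ℕ} {g : (Fin d → ℝ) → ℂ} {M : ℝ} (hg : C1Bound g M) :
    ‖fourierVec g‖ ≤ M := by
  rw [fourierVec, LinearIsometryEquiv.norm_map]
  have h := Lp.norm_le_of_ae_bound (f := toMomentum g) (p := 2) hg.nonneg (by
    filter_upwards [coeFn_toMomentum hg.contDiff.continuous, ae_mem_closedCube d] with p h1 h2
    rw [h1]
    exact hg.norm_le p h2)
  simpa [measureUnivNNReal] using h

lemma hopping_latticeFourier {d : ℕ} (f : (Fin d → ℝ) → ℝ) (u : MomentumSpace d) :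
    hopping f (latticeFourier d u) = latticeFourier d (multiplication (fun p => (f p : ℂ)) u) := by
  simp [hopping]

lemma hopping_fourierVec {d : ℕ} {f : (Fin d → ℝ) → ℝ} {g : (Fin d → ℝ) → ℂ} (hf : Continuous f)
    (hg : Continuous g) : hopping f (fourierVec g) = fourierVec fun p => f p * g p := by
  have hf' : Continuous fun p => (f p : ℂ) := Complex.continuous_ofReal.comp hf
  rw [fourierVec, hopping_latticeFourier, multiplication_toMomentum hf' hg, fourierVec]

lemma delta_eq_fourierVec {d : ℕ} (x : Lattice d) : delta x = fourierVec (character x) := by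
  have h := (characterBasis d).repr_self x
  rw [characterBasis, HilbertBasis.coe_mk] at h
  rw [fourierVec, latticeFourier, characterBasis, h, delta]

lemma isSelfAdjoint_hopping {d : ℕ} {f : (Fin d → ℝ) → ℝ} (hf : Continuous f) :
    IsSelfAdjoint (hopping f : SeqSpace d →L[ℂ] SeqSpace d) := by
  have hf' : Continuous fun p => (f p : ℂ) := Complex.continuous_ofReal.comp hf
  rw [ContinuousLinearMap.isSelfAdjoint_iff_isSymmetric]
  intro u v
  obtain ⟨u, rfl⟩ := (latticeFourier d).surjective u
  obtain ⟨v, rfl⟩ := (latticeFourier d).surjective v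
  simp only [ContinuousLinearMap.coe_coe, hopping_latticeFourier, LinearIsometryEquiv.inner_map_map]
  rw [L2.inner_def, L2.inner_def]
  refine integral_congr_ae ?_
  filter_upwards [coeFn_multiplication hf' u, coeFn_multiplication hf' v] with p h1 h2
  simp only [h1, h2, RCLike.inner_apply, map_mul, Complex.conj_ofReal]
  ring

lemma mem_resolventSet_of_isSelfAdjoint {d : ℕ} {T : SeqSpace d →L[ℂ] SeqSpace d}
    (hT : IsSelfAdjoint T) {z : ℂ} (hz : z.im ≠ 0) : z ∈ resolventSet ℂ T := by
  by_contra h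
  exact hz (hT.im_eq_zero_of_mem_spectrum h)

lemma resolvent_apply_sub {d : ℕ} {T : SeqSpace d →L[ℂ] SeqSpace d} {z : ℂ}
    (hz : z ∈ resolventSet ℂ T) (v : SeqSpace d) : resolvent T z (z • v - T v) = v := by
  have h := Ring.inverse_mul_cancel _ hz
  have h' := DFunLike.congr_fun h v
  simpa [resolvent, Algebra.algebraMap_eq_smul_one] using h'

lemma sub_resolvent_apply {d : ℕ} {T : SeqSpace d →L[ℂ] SeqSpace d} {z : ℂ}
    (hz : z ∈ resolventSet ℂ T) (v : SeqSpace d) :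
    z • resolvent T z v - T (resolvent T z v) = v := by
  have h := Ring.mul_inverse_cancel _ hz
  have h' := DFunLike.congr_fun h v
  simpa [resolvent, Algebra.algebraMap_eq_smul_one] using h'

/-- The right-hand side is a continuous symbol, so it suffices to apply `z - f` to it and use that
the resolvent is a left inverse. -/
lemma resolvent_hopping_fourierVec {d : ℕ} {f : (Fin d → ℝ) → ℝ} {g : (Fin d → ℝ) → ℂ}
    (hf : Continuous f) (hg : Continuous g) {z : ℂ} (hz : z.im ≠ 0) :
    resolvent (hopping f) z (fourierVec g) = fourierVec fun p => (z - f p)⁻¹ * g p := by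
  have hc : Continuous fun p => (z - f p)⁻¹ * g p :=
    (Continuous.inv₀ (by fun_prop) fun p => sub_ofReal_ne_zero hz (f p)).mul hg
  have hf' : Continuous fun p => (f p : ℂ) := Complex.continuous_ofReal.comp hf
  have h := resolvent_apply_sub (mem_resolventSet_of_isSelfAdjoint (isSelfAdjoint_hopping hf) hz)
    (fourierVec fun p => (z - f p)⁻¹ * g p)
  rw [← h]
  congr 1
  rw [hopping_fourierVec hf hc]
  simp only [fourierVec]
  rw [← map_smul, ← map_sub, ← toMomentum_const_mul hc,
    ← toMomentum_sub (hc.const_mul z) (hf'.fun_mul hc)]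
  congr 2
  funext p
  have := sub_ofReal_ne_zero hz (f p)
  field_simp

lemma partialDeriv_conj {d : ℕ} {g : (Fin d → ℝ) → ℂ} {p : Fin d → ℝ}
    (hg : DifferentiableAt ℝ g p) (i : Fin d) :
    partialDeriv i (fun q => (starRingEnd ℂ) (g q)) p = (starRingEnd ℂ) (partialDeriv i g p) := by
  unfold partialDeriv
  have h := (Complex.conjCLE.toContinuousLinearMap.hasFDerivAt.comp p hg.hasFDerivAt).fderiv
  change fderiv ℝ (Complex.conjCLE ∘ g) p _ = _
  rw [show fderiv ℝ (Complex.conjCLE ∘ g) p = _ from h]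
  simp

lemma contDiff_conj {d : ℕ} {g : (Fin d → ℝ) → ℂ} {n : WithTop ℕ∞} (hg : ContDiff ℝ n g) :
    ContDiff ℝ n fun q => (starRingEnd ℂ) (g q) :=
  Complex.conjCLE.contDiff.comp hg

/-- The factor `2` accounts for the two terms of the Leibniz rule. -/
lemma C1Bound.conj_mul {d : ℕ} {φ ψ : (Fin d → ℝ) → ℂ} {M N : ℝ} (hφ : C1Bound φ M)
    (hψ : C1Bound ψ N) : C1Bound (fun p => (starRingEnd ℂ) (φ p) * ψ p) (2 * (M * N)) where
  contDiff := (contDiff_conj hφ.contDiff).mul hψ.contDiff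
  periodic p k := by simp only [hφ.periodic p k, hψ.periodic p k]
  norm_le p hp := by
    rw [norm_mul, RCLike.norm_conj]
    have h1 := mul_le_mul (hφ.norm_le p hp) (hψ.norm_le p hp) (norm_nonneg _) hφ.nonneg
    have h2 := mul_nonneg hφ.nonneg hψ.nonneg
    linarith
  norm_partialDeriv_le p hp i := by
    rw [partialDeriv_mul ((contDiff_conj hφ.contDiff).differentiable one_ne_zero p)
      (hψ.contDiff.differentiable one_ne_zero p),
      partialDeriv_conj (hφ.contDiff.differentiable one_ne_zero p)]
    refine (norm_add_le _ _).trans ?_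
    rw [norm_mul, norm_mul, RCLike.norm_conj, RCLike.norm_conj, two_mul]
    exact add_le_add
      (mul_le_mul (hφ.norm_partialDeriv_le p hp i) (hψ.norm_le p hp) (norm_nonneg _) hφ.nonneg)
      (mul_le_mul (hφ.norm_le p hp) (hψ.norm_partialDeriv_le p hp i) (norm_nonneg _) hφ.nonneg)

/-- Uniform bound on matrix elements of the free resolvent between smooth states. -/
theorem IsMorse.exists_norm_inner_resolvent_le {d : ℕ} (hd : 3 ≤ d) {f : (Fin d → ℝ) → ℝ}
    (hf : IsMorse f) (hper : TorusPeriodic f) :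
    ∃ C : ℝ, 0 ≤ C ∧ ∀ z : ℂ, z.im ≠ 0 → ∀ (φ ψ : (Fin d → ℝ) → ℂ) (M N : ℝ),
      C1Bound φ M → C1Bound ψ N →
      ‖⟪fourierVec φ, resolvent (hopping f) z (fourierVec ψ)⟫_ℂ‖ ≤ C * (M * N) := by
  obtain ⟨C, hC, h⟩ := hf.exists_norm_integral_div_le hd hper
  refine ⟨C * 2, by positivity, fun z hz φ ψ M N hφ hψ => ?_⟩
  have hfc := hf.1.continuous
  have hψc := hψ.contDiff.continuous
  have hc : Continuous fun p => (z - f p)⁻¹ * ψ p :=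
    (Continuous.inv₀ (by fun_prop) fun p => sub_ofReal_ne_zero hz (f p)).mul hψc
  rw [resolvent_hopping_fourierVec hfc hψc hz, inner_fourierVec hφ.contDiff.continuous hc, mul_assoc]
  refine le_of_eq_of_le ?_ (h z hz _ _ (hφ.conj_mul hψ))
  congr 2
  funext p
  ring

/-! ### Perturbation of resolvents by sums of rank-one operators -/

/-- Pairing the resolvent identity with each `b j` bounds the weighted sum `S` of the numbers `|⟨b
j, R ψ⟩|` by `θ (s + S)`, where `θ = ∑ α j β j`. As `θ < 1`, this can be solved for `S`, and pairing
the identity with `φ` bounds the difference by `t S`. Operator norms do not enter the final bound,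
which allows uniformity in `z`. -/
theorem norm_inner_sub_le_of_hasSum {E ι : Type*} [NormedAddCommGroup E] [InnerProductSpace ℂ E]
    {a b : ι → E} {R₀ R W : E →L[ℂ] E} (hres : ∀ v, R v = R₀ v + R₀ (W (R v)))
    (hW : ∀ v, HasSum (fun j => ⟪b j, v⟫_ℂ • a j) (W v)) {α β : ι → ℝ} (hα : ∀ j, 0 ≤ α j)
    (hab : ∀ j l, ‖⟪b j, R₀ (a l)⟫_ℂ‖ ≤ β j * α l)
    (hsum : Summable fun j => α j * β j) (hθ : ∑' j, α j * β j < 1)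
    (hsumb : Summable fun j => α j * ‖b j‖) {φ ψ : E} {s t : ℝ} (hs : 0 ≤ s) (ht : 0 ≤ t)
    (hφ : ∀ l, ‖⟪φ, R₀ (a l)⟫_ℂ‖ ≤ t * α l) (hψ : ∀ j, ‖⟪b j, R₀ ψ⟫_ℂ‖ ≤ β j * s) :
    ‖⟪φ, R ψ⟫_ℂ - ⟪φ, R₀ ψ⟫_ℂ‖ ≤ t * (s / (1 - ∑' j, α j * β j)) := by
  set θ := ∑' j, α j * β j with hθdef
  -- A priori finiteness of `S`, using boundedness of the single operator `R`; without it, absorbing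
  -- `θ S` would be meaningless.
  have hX : Summable fun j => α j * ‖⟪b j, R ψ⟫_ℂ‖ := by
    refine Summable.of_nonneg_of_le (fun j => mul_nonneg (hα j) (norm_nonneg _)) (fun j => ?_)
      (hsumb.mul_right ‖R ψ‖)
    rw [mul_assoc]
    exact mul_le_mul_of_nonneg_left (norm_inner_le_norm _ _) (hα j)
  set S := ∑' j, α j * ‖⟪b j, R ψ⟫_ℂ‖ with hS
  have hS0 : 0 ≤ S := tsum_nonneg fun j => mul_nonneg (hα j) (norm_nonneg _)
  have hkey : ∀ (χ : E) (τ : ℝ), (∀ l, ‖⟪χ, R₀ (a l)⟫_ℂ‖ ≤ τ * α l) →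
      ‖⟪χ, R₀ (W (R ψ))⟫_ℂ‖ ≤ τ * S := by
    intro χ τ hχ
    have h1 : HasSum (fun j => ⟪χ, R₀ (⟪b j, R ψ⟫_ℂ • a j)⟫_ℂ) ⟪χ, R₀ (W (R ψ))⟫_ℂ :=
      ((innerSL ℂ χ).comp R₀).hasSum (hW (R ψ))
    rw [← h1.tsum_eq]
    refine tsum_of_norm_bounded (hX.hasSum.mul_left τ) fun j => ?_
    rw [map_smul, inner_smul_right, norm_mul]
    calc _ ≤ ‖⟪b j, R ψ⟫_ℂ‖ * (τ * α j) := by gcongr; exact hχ j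
      _ = _ := by ring
  have hstep : ∀ j, ‖⟪b j, R ψ⟫_ℂ‖ ≤ β j * (s + S) := fun j => by
    rw [hres ψ, inner_add_right, mul_add]
    exact (norm_add_le _ _).trans (add_le_add (hψ j) (hkey (b j) (β j) (hab j)))
  have hSle : S ≤ θ * (s + S) := by
    rw [hθdef, ← tsum_mul_right]
    refine hX.tsum_le_tsum (fun j => ?_) (hsum.mul_right _)
    rw [mul_assoc]
    exact mul_le_mul_of_nonneg_left (hstep j) (hα j)
  have hS' : S ≤ s / (1 - θ) := by
    rw [le_div_iff₀ (by linarith)]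
    nlinarith
  rw [hres ψ, inner_add_right, add_sub_cancel_left]
  exact (hkey φ t hφ).trans (mul_le_mul_of_nonneg_left hS' ht)

/-! ### Characters as C¹ test functions, and the lattice weights. -/

lemma eucl_nonneg {d : ℕ} (x : Lattice d) : 0 ≤ eucl x := Real.sqrt_nonneg _

lemma abs_le_eucl {d : ℕ} (x : Lattice d) (i : Fin d) : |(x i : ℝ)| ≤ eucl x :=
  Real.abs_le_sqrt (Finset.single_le_sum (f := fun j => (x j : ℝ) ^ 2)
    (fun _ _ => sq_nonneg _) (Finset.mem_univ i))

lemma contDiff_character {d : ℕ} (x : Lattice d) {n : WithTop ℕ∞} :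
    ContDiff ℝ n (character x) := by
  unfold character
  have h : ∀ i : Fin d, ContDiff ℝ n fun p : Fin d → ℝ => ((p i : ℝ) : ℂ) := fun i =>
    Complex.ofRealCLM.contDiff.comp (contDiff_apply ℝ ℝ i)
  exact ((contDiff_const.mul (ContDiff.sum fun i _ => (h i).mul contDiff_const)).neg).cexp

lemma norm_character {d : ℕ} (x : Lattice d) (p : Fin d → ℝ) : ‖character x p‖ = 1 := by
  have h : -(Complex.I * ∑ i, (p i : ℂ) * (x i : ℂ))
      = ((-∑ i, p i * (x i : ℝ) : ℝ) : ℂ) * Complex.I := by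
    push_cast; ring
  rw [character, h, Complex.norm_exp_ofReal_mul_I]

lemma periodic_character {d : ℕ} (x : Lattice d) : TorusPeriodic (character x) := by
  intro p k
  have h : -(Complex.I * ∑ i, (((p + Pi.single k (2 * Real.pi) : Fin d → ℝ) i : ℝ) : ℂ) * (x i : ℂ))
      = -(Complex.I * ∑ i, (p i : ℂ) * (x i : ℂ)) + ((-x k : ℤ) : ℂ) * (2 * Real.pi * Complex.I) := by
    have h1 : ∀ i, (((p + Pi.single k (2 * Real.pi) : Fin d → ℝ) i : ℝ) : ℂ) * (x i : ℂ)
        = (p i : ℂ) * (x i : ℂ) + (if i = k then 2 * (Real.pi : ℂ) * (x k : ℂ) else 0) := by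
      intro i
      rcases eq_or_ne i k with rfl | hi
      · simp; ring
      · simp [hi]
    simp only [h1, Finset.sum_add_distrib, Finset.sum_ite_eq', Finset.mem_univ, if_true]
    push_cast
    ring
  rw [character, character, h, Complex.exp_add, Complex.exp_int_mul_two_pi_mul_I, mul_one]

lemma partialDeriv_character {d : ℕ} (x : Lattice d) (i : Fin d) (p : Fin d → ℝ) :
    partialDeriv i (character x) p = -(Complex.I * (x i : ℂ)) * character x p := by
  have hproj : ∀ j : Fin d, HasFDerivAt (fun q : Fin d → ℝ => ((q j : ℝ) : ℂ))
      (Complex.ofRealCLM.comp (ContinuousLinearMap.proj j)) p := fun j =>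
    (Complex.ofRealCLM.comp (ContinuousLinearMap.proj (R := ℝ) (φ := fun _ : Fin d => ℝ) j)).hasFDerivAt
  have h1 := ((HasFDerivAt.fun_sum (u := Finset.univ)
    fun j _ => (hproj j).mul_const (x j : ℂ)).const_mul Complex.I).neg.cexp
  have h2 : HasFDerivAt (character x) _ p := h1
  unfold partialDeriv
  rw [h2.fderiv]
  simp [character, Pi.single_apply, apply_ite Complex.ofReal]
  ring

/-- First derivatives grow only linearly in `x`; the square is used so that `δₓ` and `A δₓ` carry
the same weight up to a constant. -/
lemma C1Bound.character {d : ℕ} (x : Lattice d) : C1Bound (character x) ((1 + eucl x) ^ 2) where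
  contDiff := contDiff_character x
  periodic := periodic_character x
  norm_le p _ := by
    rw [norm_character]
    nlinarith [eucl_nonneg x]
  norm_partialDeriv_le p _ i := by
    rw [partialDeriv_character, norm_mul, norm_character, norm_neg, norm_mul, Complex.norm_I,
      one_mul, mul_one, Complex.norm_intCast]
    nlinarith [eucl_nonneg x, abs_le_eucl x i]

/-- Resolvent estimate for a perturbation of a multiplication operator by a sum of rank-one
operators with small total weight. -/
theorem resolventEstimate_of_hasSum {d : ℕ} {f : (Fin d → ℝ) → ℝ} (hf : Continuous f) {C : ℝ}
    (hC : 0 ≤ C)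
    (hfree : ∀ z : ℂ, z.im ≠ 0 → ∀ (φ ψ : (Fin d → ℝ) → ℂ) (M N : ℝ),
      C1Bound φ M → C1Bound ψ N →
      ‖⟪fourierVec φ, resolvent (hopping f) z (fourierVec ψ)⟫_ℂ‖ ≤ C * (M * N))
    {T : SeqSpace d →L[ℂ] SeqSpace d} (hT : IsSelfAdjoint T) {ι : Type*} {v : ι → ℂ}
    {ξ η : ι → (Fin d → ℝ) → ℂ} {m n : ι → ℝ} (hξ : ∀ j, C1Bound (ξ j) (m j))
    (hη : ∀ j, C1Bound (η j) (n j)) (hsum : Summable fun j => ‖v j‖ * (m j * n j))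
    (hsmall : C * ∑' j, ‖v j‖ * (m j * n j) < 1)
    (hW : ∀ u, HasSum (fun j => ⟪fourierVec (η j), u⟫_ℂ • v j • fourierVec (ξ j))
      ((T - hopping f) u)) :
    ResolventEstimate T := by
  have heq : ∀ j, C * ‖v j‖ * m j * n j = C * (‖v j‖ * (m j * n j)) := fun j => by ring
  refine ⟨C + C / (1 - C * ∑' j, ‖v j‖ * (m j * n j)), fun z hz => ?_⟩
  have hzT := mem_resolventSet_of_isSelfAdjoint hT hz
  have hz₀ := mem_resolventSet_of_isSelfAdjoint (isSelfAdjoint_hopping hf) hz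
  refine ⟨hzT, fun x y => ?_⟩
  -- The second resolvent identity, obtained by applying the free resolvent to `(z - f) (z - T)⁻¹
  -- u`.
  have hres : ∀ u, resolvent T z u = resolvent (hopping f) z u
      + resolvent (hopping f) z ((T - hopping f) (resolvent T z u)) := fun u => by
    have h1 := resolvent_apply_sub hz₀ (resolvent T z u)
    have h2 : z • resolvent T z u - hopping f (resolvent T z u)
        = u + (T - hopping f) (resolvent T z u) := by
      rw [sub_apply]
      conv_rhs => enter [1]; rw [← sub_resolvent_apply hzT u]
      abel
    rw [h2, map_add] at h1
    exact h1.symm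
  have hinner : ∀ (φ : (Fin d → ℝ) → ℂ) (M : ℝ), C1Bound φ M → ∀ l,
      ‖⟪fourierVec φ, resolvent (hopping f) z (v l • fourierVec (ξ l))⟫_ℂ‖
        ≤ M * (C * ‖v l‖ * m l) := fun φ M hφ l => by
    rw [map_smul, inner_smul_right, norm_mul]
    calc _ ≤ ‖v l‖ * (C * (M * m l)) := by gcongr; exact hfree z hz _ _ _ _ hφ (hξ l)
      _ = _ := by ring
  have hwx := C1Bound.character x
  have hwy := C1Bound.character y
  rw [delta_eq_fourierVec, delta_eq_fourierVec]
  -- The free constant `C` and the coefficient `|v j|` are both put into `α`, so that `∑ α j β j` is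
  -- the quantity assumed to be less than one.
  have hpert := norm_inner_sub_le_of_hasSum (a := fun j => v j • fourierVec (ξ j))
    (b := fun j => fourierVec (η j)) (W := T - hopping f) hres hW
    (α := fun j => C * ‖v j‖ * m j) (β := n)
    (fun j => mul_nonneg (mul_nonneg hC (norm_nonneg _)) (hξ j).nonneg)
    (fun j l => hinner _ _ (hη j) l)
    (by simp only [heq]; exact hsum.mul_left C)
    (by simp only [heq]; rwa [tsum_mul_left])
    (by
      refine Summable.of_nonneg_of_le
        (fun j => mul_nonneg (mul_nonneg (mul_nonneg hC (norm_nonneg _)) (hξ j).nonneg)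
          (norm_nonneg _)) (fun j => ?_) (hsum.mul_left C)
      rw [← heq]
      exact mul_le_mul_of_nonneg_left (norm_fourierVec_le (hη j))
        (mul_nonneg (mul_nonneg hC (norm_nonneg _)) (hξ j).nonneg))
    (φ := fourierVec (character x)) (ψ := fourierVec (character y))
    (s := C * (1 + eucl y) ^ 2) (t := (1 + eucl x) ^ 2)
    (mul_nonneg hC hwy.nonneg) hwx.nonneg (fun l => hinner _ _ hwx l)
    (fun j => (hfree z hz _ _ _ _ (hη j) hwy).trans (le_of_eq (by ring)))
  simp only [heq] at hpert
  rw [tsum_mul_left] at hpert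
  have h0 := hfree z hz _ _ _ _ hwx hwy
  set P := ⟪fourierVec (character x), resolvent T z (fourierVec (character y))⟫_ℂ
  set Q := ⟪fourierVec (character x), resolvent (hopping f) z (fourierVec (character y))⟫_ℂ
  calc ‖P‖ = ‖(P - Q) + Q‖ := by rw [sub_add_cancel]
    _ ≤ _ := norm_add_le _ _
    _ ≤ _ := add_le_add hpert h0
    _ = _ := by ring

/-- With `a x = |V x| ^ (1/2) (|x| + 1) ^ n` and `n ≥ 2`, each weighted term is at most `(a x)²`,
and `∑ a² ≤ (∑ a)²`, which is `Phi`. -/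
lemma summable_of_mul_Phi_lt_one {d : ℕ} {c : ℝ} (hc : 0 < c) {n : ℕ} (hn : 2 ≤ n)
    {V : Lattice d → ℝ} (h : ENNReal.ofReal c * Phi 2 n V < 1) :
    Summable (fun x => |V x| * ((1 + eucl x) ^ 2 * (1 + eucl x) ^ 2)) ∧
      c * ∑' x, |V x| * ((1 + eucl x) ^ 2 * (1 + eucl x) ^ 2) < 1 := by
  set a : Lattice d → ℝ := fun x => |V x| ^ (1 / ((2 : ℕ) : ℝ)) * (eucl x + 1) ^ n with ha
  have hpos : ∀ x : Lattice d, 1 ≤ eucl x + 1 := fun x => by linarith [eucl_nonneg x]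
  have ha0 : ∀ x, 0 ≤ a x := fun x =>
    mul_nonneg (Real.rpow_nonneg (abs_nonneg _) _) (pow_nonneg (by linarith [hpos x]) _)
  have hPhi : Phi 2 n V = (∑' x, ENNReal.ofReal (a x)) ^ 2 := rfl
  -- Positivity of `c` matters: an infinite `Phi` then makes the product infinite, contradicting the
  -- hypothesis.
  have hfin : ∑' x, ENNReal.ofReal (a x) ≠ ⊤ := fun htop => by
    rw [hPhi, htop, ENNReal.top_pow two_ne_zero, ENNReal.mul_top (by simpa using hc)] at h
    exact absurd h (by simp)
  have hsum : Summable a := by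
    have := ENNReal.summable_toReal hfin
    exact this.congr fun x => ENNReal.toReal_ofReal (ha0 x)
  set S := ∑' x, a x with hS
  rw [hPhi, ← ENNReal.ofReal_tsum_of_nonneg ha0 hsum, ← ENNReal.ofReal_pow (tsum_nonneg ha0),
    ← ENNReal.ofReal_mul hc.le, ENNReal.ofReal_lt_one] at h
  have hle : ∀ x, |V x| * ((1 + eucl x) ^ 2 * (1 + eucl x) ^ 2) ≤ S * a x := fun x => by
    have h1 : |V x| = (|V x| ^ (1 / ((2 : ℕ) : ℝ))) ^ 2 := by
      rw [← Real.rpow_natCast, ← Real.rpow_mul (abs_nonneg _)]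
      norm_num
    have h2 : (1 + eucl x) ^ 2 ≤ (eucl x + 1) ^ n := by
      rw [add_comm]; exact pow_le_pow_right₀ (hpos x) hn
    have h3 : 0 ≤ (eucl x + 1) ^ n := pow_nonneg (by linarith [hpos x]) _
    calc |V x| * ((1 + eucl x) ^ 2 * (1 + eucl x) ^ 2)
        ≤ |V x| * ((eucl x + 1) ^ n * (eucl x + 1) ^ n) := by gcongr
      _ = a x * a x := by
          rw [ha]; conv_lhs => enter [1]; rw [h1]
          ring
      _ ≤ S * a x := mul_le_mul_of_nonneg_right (hsum.le_tsum x fun y _ => ha0 y) (ha0 x)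
  have hsum' : Summable (fun x => |V x| * ((1 + eucl x) ^ 2 * (1 + eucl x) ^ 2)) :=
    Summable.of_nonneg_of_le (fun x => by positivity) hle (hsum.mul_left S)
  refine ⟨hsum', lt_of_le_of_lt ?_ h⟩
  refine mul_le_mul_of_nonneg_left ?_ hc.le
  refine (hsum'.tsum_le_tsum hle (hsum.mul_left S)).trans (le_of_eq ?_)
  rw [tsum_mul_left, pow_two]

/-! ### The potential as a sum of rank-one operators, and the Hamiltonian. -/

lemma inner_delta_left {d : ℕ} (x : Lattice d) (u : SeqSpace d) : ⟪delta x, u⟫_ℂ = u x := by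
  rw [delta, lp.inner_single_left]
  simp

lemma potentialOp_apply {d : ℕ} (V : Potential d) (u : SeqSpace d) (x : Lattice d) :
    potentialOp V u x = (V x : ℂ) * u x := rfl

lemma isSelfAdjoint_potentialOp {d : ℕ} (V : Potential d) : IsSelfAdjoint (potentialOp V) := by
  rw [ContinuousLinearMap.isSelfAdjoint_iff_isSymmetric]
  intro u w
  simp only [ContinuousLinearMap.coe_coe]
  rw [lp.inner_eq_tsum, lp.inner_eq_tsum]
  refine tsum_congr fun x => ?_
  simp only [potentialOp_apply, RCLike.inner_apply, map_mul, Complex.conj_ofReal]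
  ring

lemma hasSum_potentialOp {d : ℕ} (V : Potential d) (u : SeqSpace d) :
    HasSum (fun x => ⟪delta x, u⟫_ℂ • (V x : ℂ) • delta x) (potentialOp V u) := by
  have h := lp.hasSum_single (p := 2) (by simp) (potentialOp V u)
  convert h using 2 with x
  rw [inner_delta_left, potentialOp_apply, delta, smul_smul, ← lp.single_smul, smul_eq_mul, mul_one,
    mul_comm]

theorem resolventEstimate_hamiltonian {d : ℕ} {e : (Fin d → ℝ) → ℝ} (he : Continuous e) {C : ℝ}
    (hC : 0 < C)
    (hfree : ∀ z : ℂ, z.im ≠ 0 → ∀ (φ ψ : (Fin d → ℝ) → ℂ) (M N : ℝ),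
      C1Bound φ M → C1Bound ψ N →
      ‖⟪fourierVec φ, resolvent (hopping e) z (fourierVec ψ)⟫_ℂ‖ ≤ C * (M * N))
    {V : Potential d} (hV : ENNReal.ofReal C * Phi 2 2 V < 1) :
    ResolventEstimate (hamiltonian e V) := by
  obtain ⟨hsum, hsmall⟩ := summable_of_mul_Phi_lt_one hC le_rfl hV
  refine resolventEstimate_of_hasSum he hC.le hfree
    ((isSelfAdjoint_hopping he).add (isSelfAdjoint_potentialOp V)) (v := fun x => (V x : ℂ))
    (fun x => C1Bound.character x) (fun x => C1Bound.character x) ?_ ?_ fun u => ?_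
  · simpa only [Complex.norm_real, Real.norm_eq_abs] using hsum
  · simpa only [Complex.norm_real, Real.norm_eq_abs] using hsmall
  · have h := hasSum_potentialOp V u
    simp only [delta_eq_fourierVec] at h
    simpa [hamiltonian] using h

/-! ### The conjugate operator -/

section Conjugate

variable {d : ℕ} {e : (Fin d → ℝ) → ℝ}

lemma contDiff_conjugateExpr (he : ContDiff ℝ 3 e) {g : (Fin d → ℝ) → ℂ} (hg : ContDiff ℝ 2 g) :
    ContDiff ℝ 1 (conjugateExpr e g) := by
  have h1 : ∀ k, ContDiff ℝ 2 (partialDeriv k e) := fun k =>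
    contDiff_partialDeriv he (by norm_num) k
  refine contDiff_const.mul (ContDiff.sum fun k _ => ?_)
  refine ((Complex.ofRealCLM.contDiff.comp ((h1 k).of_le one_le_two)).mul
    (contDiff_partialDeriv hg (by norm_num) k)).add
    ((contDiff_const.mul (Complex.ofRealCLM.contDiff.comp
      (contDiff_partialDeriv (h1 k) (by norm_num) k))).mul (hg.of_le one_le_two))

lemma periodic_conjugateExpr (hper : TorusPeriodic e) {g : (Fin d → ℝ) → ℂ}
    (hg : TorusPeriodic g) : TorusPeriodic (conjugateExpr e g) := fun p k => by
  simp only [conjugateExpr, hper.partialDeriv _ p k, hg.partialDeriv _ p k, hg p k,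
    (hper.partialDeriv _).partialDeriv _ p k]

/-- The function `Λₓ` with `Â χₓ = χₓ Λₓ` for the character `χₓ`. -/
noncomputable def conjugateSymbol (e : (Fin d → ℝ) → ℝ) (x : Lattice d) (p : Fin d → ℝ) : ℂ :=
  ∑ k, ((x k : ℂ) * Complex.ofReal (partialDeriv k e p)
    + Complex.I / 2 * Complex.ofReal (partialDeriv k (partialDeriv k e) p))

lemma conjugateExpr_character (e : (Fin d → ℝ) → ℝ) (x : Lattice d) :
    conjugateExpr e (character x) = fun p => character x p * conjugateSymbol e x p := by
  funext p
  simp only [conjugateExpr, conjugateSymbol, partialDeriv_character, Finset.mul_sum]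
  refine Finset.sum_congr rfl fun k _ => ?_
  linear_combination (-(x k : ℂ) * Complex.ofReal (partialDeriv k e p) * character x p)
    * Complex.I_mul_I

/-- By `conjugateExpr_character` the function is the character times a symbol affine in `x`.
Differentiating the character brings down one more factor of size `|x|`, hence quadratic growth.
Derivatives of `e` up to order three enter. -/
lemma exists_C1Bound_conjugateExpr_character (he : ContDiff ℝ 3 e) (hper : TorusPeriodic e) :
    ∃ K : ℝ, 0 ≤ K ∧ ∀ x : Lattice d,
      C1Bound (conjugateExpr e (character x)) (K * (1 + eucl x) ^ 2) := by
  have h1 : ∀ k, ContDiff ℝ 2 (partialDeriv k e) := fun k =>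
    contDiff_partialDeriv he (by norm_num) k
  have h2 : ∀ k, ContDiff ℝ 1 (partialDeriv k (partialDeriv k e)) := fun k =>
    contDiff_partialDeriv (h1 k) (by norm_num) k
  have h1' : ∀ k, ContDiff ℝ 1 (partialDeriv k e) := fun k => (h1 k).of_le one_le_two
  obtain ⟨A, hA0, hA⟩ := exists_bound_on_cube (f := fun k : Fin d => partialDeriv k e)
    fun k => (h1 k).continuous
  obtain ⟨B, hB0, hB⟩ := exists_bound_on_cube
    (f := fun k : Fin d => partialDeriv k (partialDeriv k e)) fun k => (h2 k).continuous
  obtain ⟨A', hA0', hA'⟩ := exists_bound_on_cube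
    (f := fun ik : Fin d × Fin d => partialDeriv ik.1 (partialDeriv ik.2 e))
    fun ik => continuous_partialDeriv (h1' ik.2) ik.1
  obtain ⟨B', hB0', hB'⟩ := exists_bound_on_cube
    (f := fun ik : Fin d × Fin d => partialDeriv ik.1 (partialDeriv ik.2 (partialDeriv ik.2 e)))
    fun ik => continuous_partialDeriv (h2 ik.2) ik.1
  set K := A + B + A' + B' with hK
  have hsum_le : ∀ (x : Lattice d) (a b : Fin d → ℝ), (∀ k, |a k| ≤ K) → (∀ k, |b k| ≤ K) →
      ‖∑ k, ((x k : ℂ) * Complex.ofReal (a k) + Complex.I / 2 * Complex.ofReal (b k))‖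
        ≤ d * K * (1 + eucl x) := by
    intro x a b ha hb
    refine (norm_sum_le _ _).trans ?_
    refine (Finset.sum_le_card_nsmul _ _ (K * (1 + eucl x)) fun k _ => ?_).trans
      (le_of_eq (by simp; ring))
    refine (norm_add_le _ _).trans ?_
    rw [norm_mul, norm_mul, Complex.norm_real, Complex.norm_real, Complex.norm_intCast, norm_div,
      Complex.norm_I, Complex.norm_ofNat, Real.norm_eq_abs, Real.norm_eq_abs]
    have h3 := mul_le_mul (abs_le_eucl x k) (ha k) (abs_nonneg _) (eucl_nonneg x)
    have h4 := hb k
    have h5 := abs_nonneg (b k)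
    linarith
  have hdiff : ∀ x : Lattice d, ∀ k, ContDiff ℝ 1 fun p =>
      (x k : ℂ) * Complex.ofReal (partialDeriv k e p)
        + Complex.I / 2 * Complex.ofReal (partialDeriv k (partialDeriv k e) p) := fun x k =>
    (contDiff_const.mul (Complex.ofRealCLM.contDiff.comp (h1' k))).add
      (contDiff_const.mul (Complex.ofRealCLM.contDiff.comp (h2 k)))
  have hsd : ∀ x : Lattice d, ContDiff ℝ 1 (conjugateSymbol e x) := fun x =>
    ContDiff.sum fun k _ => hdiff x k
  have hs : ∀ x : Lattice d, ∀ p ∈ cube d, ‖conjugateSymbol e x p‖ ≤ d * K * (1 + eucl x) :=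
    fun x p hp => hsum_le x _ _ (fun k => (hA k p hp).trans (by linarith))
      (fun k => (hB k p hp).trans (by linarith))
  have hs' : ∀ x : Lattice d, ∀ p ∈ cube d, ∀ i,
      ‖partialDeriv i (conjugateSymbol e x) p‖ ≤ d * K * (1 + eucl x) := fun x p hp i => by
    have hform : partialDeriv i (conjugateSymbol e x) p
        = ∑ k, ((x k : ℂ) * Complex.ofReal (partialDeriv i (partialDeriv k e) p)
          + Complex.I / 2 * Complex.ofReal (partialDeriv i (partialDeriv k (partialDeriv k e)) p)) := by
      unfold conjugateSymbol
      rw [partialDeriv_sum fun k _ => (hdiff x k).differentiable one_ne_zero p]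
      refine Finset.sum_congr rfl fun k _ => ?_
      have h3 := ((h1' k).differentiable one_ne_zero p).hasFDerivAt
      have h4 := ((h2 k).differentiable one_ne_zero p).hasFDerivAt
      have h5 := ((Complex.ofRealCLM.hasFDerivAt.comp p h3).const_mul (x k : ℂ)).add
        ((Complex.ofRealCLM.hasFDerivAt.comp p h4).const_mul (Complex.I / 2))
      have h6 : HasFDerivAt (fun p => (x k : ℂ) * Complex.ofReal (partialDeriv k e p)
        + Complex.I / 2 * Complex.ofReal (partialDeriv k (partialDeriv k e) p)) _ p := h5
      exact DFunLike.congr_fun h6.fderiv (Pi.single i 1)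
    rw [hform]
    exact hsum_le x _ _ (fun k => (hA' (i, k) p hp).trans (by linarith))
      (fun k => (hB' (i, k) p hp).trans (by linarith))
  refine ⟨d * K, by positivity, fun x => ⟨contDiff_conjugateExpr he (contDiff_character x),
    periodic_conjugateExpr hper (periodic_character x), fun p hp => ?_, fun p hp i => ?_⟩⟩
  · rw [conjugateExpr_character, norm_mul, norm_character, one_mul]
    refine (hs x p hp).trans (mul_le_mul_of_nonneg_left ?_ (by positivity))
    nlinarith [eucl_nonneg x]
  · rw [conjugateExpr_character, partialDeriv_mul
      ((contDiff_character x (n := 1)).differentiable one_ne_zero p)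
      ((hsd x).differentiable one_ne_zero p), partialDeriv_character]
    refine (norm_add_le _ _).trans ?_
    rw [norm_mul, norm_mul, norm_mul, norm_character, norm_neg, norm_mul, Complex.norm_I,
      Complex.norm_intCast, one_mul, mul_one, one_mul]
    calc _ ≤ eucl x * (d * K * (1 + eucl x)) + d * K * (1 + eucl x) :=
          add_le_add (mul_le_mul (abs_le_eucl x i) (hs x p hp) (norm_nonneg _) (eucl_nonneg x))
            (hs' x p hp i)
      _ = _ := by ring

/-- The commutator of `Â` with multiplication by `Ψ(e)`, as a form. -/
lemma integral_comp_mul_conjugateExpr (he : ContDiff ℝ 2 e) (hper : TorusPeriodic e) {Ψ : ℝ → ℂ}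
    (hΨ : ContDiff ℝ 1 Ψ) {g h : (Fin d → ℝ) → ℂ} (hg : ContDiff ℝ 1 g) (hh : ContDiff ℝ 1 h)
    (hgper : TorusPeriodic g) (hhper : TorusPeriodic h) :
    ∫ p, Ψ (e p) * ((starRingEnd ℂ) (g p) * conjugateExpr e h p
        - (starRingEnd ℂ) (conjugateExpr e g p) * h p) ∂(brillouinMeasure d)
      = -Complex.I * ∫ p, deriv Ψ (e p) * ((gradSq e p : ℂ) * ((starRingEnd ℂ) (g p) * h p))
        ∂(brillouinMeasure d) := by
  have h1 : ∀ k, ContDiff ℝ 1 (partialDeriv k e) := fun k =>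
    contDiff_partialDeriv he (by norm_num) k
  have hgc := contDiff_conj hg
  have hY : ∀ k, ContDiff ℝ 1 fun p =>
      Complex.ofReal (partialDeriv k e p) * ((starRingEnd ℂ) (g p) * h p) := fun k =>
    (Complex.ofRealCLM.contDiff.comp (h1 k)).mul (hgc.mul hh)
  have hYper : ∀ k, TorusPeriodic fun p =>
      Complex.ofReal (partialDeriv k e p) * ((starRingEnd ℂ) (g p) * h p) := fun k p j => by
    simp only [hper.partialDeriv k p j, hgper p j, hhper p j]
  have key := integral_deriv_comp_mul_sum (he.of_le one_le_two) hper hΨ hY hYper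
  have hL : ∀ p, Ψ (e p) * ((starRingEnd ℂ) (g p) * conjugateExpr e h p
        - (starRingEnd ℂ) (conjugateExpr e g p) * h p)
      = Complex.I * (Ψ (e p) * ∑ k, partialDeriv k (fun q =>
        Complex.ofReal (partialDeriv k e q) * ((starRingEnd ℂ) (g q) * h q)) p) := fun p => by
    have hk : ∀ k, partialDeriv k (fun q =>
        Complex.ofReal (partialDeriv k e q) * ((starRingEnd ℂ) (g q) * h q)) p
        = Complex.ofReal (partialDeriv k (partialDeriv k e) p) * ((starRingEnd ℂ) (g p) * h p)
          + Complex.ofReal (partialDeriv k e p) * ((starRingEnd ℂ) (partialDeriv k g p) * h p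
            + (starRingEnd ℂ) (g p) * partialDeriv k h p) := fun k => by
      have d1 := (h1 k).differentiable one_ne_zero p
      have d2 := hgc.differentiable one_ne_zero p
      have d3 := hh.differentiable one_ne_zero p
      rw [partialDeriv_mul (f := fun q => Complex.ofReal (partialDeriv k e q))
        (Complex.ofRealCLM.differentiableAt.comp p d1) (d2.fun_mul d3), partialDeriv_ofReal d1,
        partialDeriv_mul d2 d3, partialDeriv_conj (hg.differentiable one_ne_zero p)]
    simp only [hk, conjugateExpr, map_mul, map_sum, map_add, Complex.conj_I, Complex.conj_ofReal,
      map_div₀, map_one, map_ofNat, Finset.mul_sum, Finset.sum_mul, ← Finset.sum_sub_distrib]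
    refine Finset.sum_congr rfl fun k _ => ?_
    ring
  have hR : ∀ p, deriv Ψ (e p) * ((gradSq e p : ℂ) * ((starRingEnd ℂ) (g p) * h p))
      = deriv Ψ (e p) * ∑ k, Complex.ofReal (partialDeriv k e p) *
        (Complex.ofReal (partialDeriv k e p) * ((starRingEnd ℂ) (g p) * h p)) := fun p => by
    rw [gradSq]
    push_cast
    rw [Finset.sum_mul]
    congr 1
    exact Finset.sum_congr rfl fun k _ => by ring
  simp only [hL, hR]
  rw [integral_const_mul, key]
  ring

/-- Symmetry of `A`: the case `Ψ = 1` of `integral_comp_mul_conjugateExpr`, where the right-hand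
side vanishes. -/
lemma inner_fourierVec_conjugateExpr (he : ContDiff ℝ 3 e) (hper : TorusPeriodic e)
    {g h : (Fin d → ℝ) → ℂ} (hg : ContDiff ℝ 2 g) (hh : ContDiff ℝ 2 h)
    (hgper : TorusPeriodic g) (hhper : TorusPeriodic h) :
    ⟪fourierVec g, fourierVec (conjugateExpr e h)⟫_ℂ
      = ⟪fourierVec (conjugateExpr e g), fourierVec h⟫_ℂ := by
  have hAg := (contDiff_conjugateExpr he hg).continuous
  have hAh := (contDiff_conjugateExpr he hh).continuous
  have hg0 := hg.continuous
  have hh0 := hh.continuous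
  have key := integral_comp_mul_conjugateExpr (he.of_le (by norm_num)) hper (Ψ := fun _ => 1)
    contDiff_const (hg.of_le one_le_two) (hh.of_le one_le_two) hgper hhper
  simp only [one_mul, deriv_const', zero_mul, integral_zero, mul_zero] at key
  rw [inner_fourierVec hg0 hAh, inner_fourierVec hAg hh0, ← sub_eq_zero, ← key]
  refine (integral_sub ?_ ?_).symm
  · exact integrable_brillouin_of_continuous (by fun_prop)
  · exact integrable_brillouin_of_continuous (by fun_prop)

/-- The case `Ψ = id`: the commutator of the first-order operator with multiplication by `e` is
multiplication by `|∇e|²`. -/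
lemma commutator_hopping (he : ContDiff ℝ 3 e) (hper : TorusPeriodic e)
    {g h : (Fin d → ℝ) → ℂ} (hg : ContDiff ℝ 2 g) (hh : ContDiff ℝ 2 h)
    (hgper : TorusPeriodic g) (hhper : TorusPeriodic h) :
    Complex.I * (⟪hopping e (fourierVec g), fourierVec (conjugateExpr e h)⟫_ℂ
        - ⟪fourierVec (conjugateExpr e g), hopping e (fourierVec h)⟫_ℂ)
      = ⟪fourierVec g, hopping (gradSq e) (fourierVec h)⟫_ℂ := by
  have he0 := he.continuous
  have hAg := (contDiff_conjugateExpr he hg).continuous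
  have hAh := (contDiff_conjugateExpr he hh).continuous
  have hg0 := hg.continuous
  have hh0 := hh.continuous
  have hG : Continuous (gradSq e) := continuous_gradSq (he.of_le (by norm_num))
  have key := integral_comp_mul_conjugateExpr (he.of_le (by norm_num)) hper (Ψ := fun s => (s : ℂ))
    Complex.ofRealCLM.contDiff (hg.of_le one_le_two) (hh.of_le one_le_two) hgper hhper
  have hderiv : ∀ s : ℝ, deriv (fun s : ℝ => (s : ℂ)) s = 1 := fun s =>
    (Complex.ofRealCLM.hasDerivAt (x := s)).deriv
  simp only [hderiv, one_mul] at key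
  rw [hopping_fourierVec he0 hg0, hopping_fourierVec he0 hh0, hopping_fourierVec hG hh0,
    inner_fourierVec (by fun_prop) hAh, inner_fourierVec hAg (by fun_prop),
    inner_fourierVec hg0 (by fun_prop), ← integral_sub
      (integrable_brillouin_of_continuous (by fun_prop))
      (integrable_brillouin_of_continuous (by fun_prop))]
  have hL : ∀ p, (starRingEnd ℂ) (e p * g p) * conjugateExpr e h p
      - (starRingEnd ℂ) (conjugateExpr e g p) * (e p * h p)
      = (e p : ℂ) * ((starRingEnd ℂ) (g p) * conjugateExpr e h p
        - (starRingEnd ℂ) (conjugateExpr e g p) * h p) := fun p => by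
    rw [map_mul, Complex.conj_ofReal]
    ring
  simp only [hL, key]
  rw [← mul_assoc, mul_neg, Complex.I_mul_I, neg_neg, one_mul]
  congr 1
  funext p
  ring

end Conjugate

/-! ### The commutator with the potential -/

/-- The norm of a rank-one operator is the product of the norms of its vectors, so the series
converges absolutely in operator norm. -/
lemma exists_hasSum_rankOne {E ι : Type*} [NormedAddCommGroup E] [InnerProductSpace ℂ E]
    [CompleteSpace E] {a b : ι → E} (h : Summable fun j => ‖a j‖ * ‖b j‖) :
    ∃ W : E →L[ℂ] E, ∀ u, HasSum (fun j => ⟪b j, u⟫_ℂ • a j) (W u) := by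
  have hs : Summable fun j => InnerProductSpace.rankOne ℂ (a j) (b j) :=
    Summable.of_norm (by simpa using h)
  obtain ⟨W, hW⟩ := hs
  refine ⟨W, fun u => ?_⟩
  have h1 := hW.mapL (ContinuousLinearMap.apply ℂ E u)
  simpa only [ContinuousLinearMap.apply_apply, InnerProductSpace.rankOne_apply] using h1

section Commutator

variable {d : ℕ} {e : (Fin d → ℝ) → ℝ}

/-- The vector `A δₓ`. -/
noncomputable def conjugateDelta (e : (Fin d → ℝ) → ℝ) (x : Lattice d) : SeqSpace d :=
  fourierVec (conjugateExpr e (character x))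

lemma mem_conjugateGraph_iff {u : SeqSpace d × SeqSpace d} :
    u ∈ conjugateGraph e ↔ ∃ g : (Fin d → ℝ) → ℂ, ContDiff ℝ ∞ g ∧ TorusPeriodic g ∧
      u.1 = fourierVec g ∧ u.2 = fourierVec (conjugateExpr e g) := Iff.rfl

lemma delta_mem_conjugateGraph (x : Lattice d) : (delta x, conjugateDelta e x) ∈ conjugateGraph e :=
  ⟨character x, contDiff_character x, periodic_character x, delta_eq_fourierVec x, rfl⟩

lemma eq_of_forall_delta {B B' : SeqSpace d →L[ℂ] SeqSpace d}
    (h : ∀ x y, ⟪delta x, B (delta y)⟫_ℂ = ⟪delta x, B' (delta y)⟫_ℂ) : B = B' := by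
  have hdelta : ∀ y, B (delta y) = B' (delta y) := fun y => by
    ext x
    rw [← inner_delta_left, ← inner_delta_left, h]
  ext1 u
  have hu : HasSum (fun x => u x • delta x) u := by
    convert lp.hasSum_single (p := 2) (by simp) u using 2 with x
    rw [delta, ← lp.single_smul, smul_eq_mul, mul_one]
  have h1 := B.hasSum hu
  have h2 := B'.hasSum hu
  simp only [map_smul, hdelta] at h1 h2
  exact h1.unique h2

/-- The vectors `δₓ` belong to the domain of `A`, so the form fixes every matrix element. -/
lemma IsCommutator.unique {H B B' : SeqSpace d →L[ℂ] SeqSpace d} (hB : IsCommutator e H B)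
    (hB' : IsCommutator e H B') : B' = B :=
  eq_of_forall_delta fun x y => by
    rw [hB' _ (delta_mem_conjugateGraph x) _ (delta_mem_conjugateGraph y),
      hB _ (delta_mem_conjugateGraph x) _ (delta_mem_conjugateGraph y)]

/-- The commutator of `H(e, V)` with the conjugate operator: if `P` and `Q` are the sums
of `i V(x) |δₓ⟩⟨A δₓ|` and of `-i V(x) |A δₓ⟩⟨δₓ|`, it is `F |∇e|² F* + P + Q`. -/
lemma isCommutator_hamiltonian (he : ContDiff ℝ 3 e) (hper : TorusPeriodic e) {V : Potential d}
    {P Q : SeqSpace d →L[ℂ] SeqSpace d}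
    (hP : ∀ u, HasSum (fun x => ⟪conjugateDelta e x, u⟫_ℂ • (Complex.I * V x) • delta x) (P u))
    (hQ : ∀ u, HasSum (fun x => ⟪delta x, u⟫_ℂ • (-(Complex.I * V x)) • conjugateDelta e x) (Q u)) :
    IsCommutator e (hamiltonian e V) (hopping (gradSq e) + (P + Q)) := by
  intro u hu v hv
  obtain ⟨g, hg, hgper, hu1, hu2⟩ := mem_conjugateGraph_iff.1 hu
  obtain ⟨h, hh, hhper, hv1, hv2⟩ := mem_conjugateGraph_iff.1 hv
  have hg2 : ContDiff ℝ 2 g := mod_cast contDiff_infty.1 hg 2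
  have hh2 : ContDiff ℝ 2 h := mod_cast contDiff_infty.1 hh 2
  have hfree := commutator_hopping he hper hg2 hh2 hgper hhper
  rw [← hu1, ← hu2, ← hv1, ← hv2] at hfree
  have hP' : HasSum (fun x => ⟪u.1, ⟪conjugateDelta e x, v.1⟫_ℂ • (Complex.I * V x) • delta x⟫_ℂ)
      ⟪u.1, P v.1⟫_ℂ := (innerSL ℂ u.1).hasSum (hP v.1)
  have hQ' : HasSum
      (fun x => ⟪u.1, ⟪delta x, v.1⟫_ℂ • (-(Complex.I * V x)) • conjugateDelta e x⟫_ℂ)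
      ⟪u.1, Q v.1⟫_ℂ := (innerSL ℂ u.1).hasSum (hQ v.1)
  have hV1 : HasSum (fun x => ⟪u.1, ⟪delta x, v.2⟫_ℂ • (V x : ℂ) • delta x⟫_ℂ)
      ⟪u.1, potentialOp V v.2⟫_ℂ := (innerSL ℂ u.1).hasSum (hasSum_potentialOp V v.2)
  have hV2 : HasSum (fun x => ⟪u.2, ⟪delta x, v.1⟫_ℂ • (V x : ℂ) • delta x⟫_ℂ)
      ⟪u.2, potentialOp V v.1⟫_ℂ := (innerSL ℂ u.2).hasSum (hasSum_potentialOp V v.1)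
  -- Symmetry of `A` moves it from the domain vector onto `δₓ`; this turns the form commutator with
  -- `V` into bounded rank-one terms.
  have hsv : ∀ x, ⟪delta x, v.2⟫_ℂ = ⟪conjugateDelta e x, v.1⟫_ℂ := fun x => by
    rw [hv1, hv2, delta_eq_fourierVec, conjugateDelta]
    exact inner_fourierVec_conjugateExpr he hper (contDiff_character x) hh2 (periodic_character x)
      hhper
  have hsu : ∀ x, ⟪u.2, delta x⟫_ℂ = ⟪u.1, conjugateDelta e x⟫_ℂ := fun x => by
    rw [hu1, hu2, delta_eq_fourierVec, conjugateDelta]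
    exact (inner_fourierVec_conjugateExpr he hper hg2 (contDiff_character x) hgper
      (periodic_character x)).symm
  have hP'' : ⟪u.1, P v.1⟫_ℂ = Complex.I * ⟪u.1, potentialOp V v.2⟫_ℂ := by
    refine hP'.unique ?_
    convert! hV1.mul_left Complex.I using 1
    funext x
    simp only [inner_smul_right, hsv]
    ring
  have hQ'' : ⟪u.1, Q v.1⟫_ℂ = -Complex.I * ⟪u.2, potentialOp V v.1⟫_ℂ := by
    refine hQ'.unique ?_
    convert! hV2.mul_left (-Complex.I) using 1
    funext x
    simp only [inner_smul_right, hsu]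
    ring
  have hsymm : ⟪potentialOp V u.1, v.2⟫_ℂ = ⟪u.1, potentialOp V v.2⟫_ℂ :=
    (isSelfAdjoint_potentialOp V).isSymmetric u.1 v.2
  simp only [hamiltonian, add_apply, inner_add_left, inner_add_right, hP'', hQ'', hsymm, ← hfree]
  ring

/-- Conjugating the series termwise shows that `P` and `Q` are adjoint to each other, because `V` is
real. -/
lemma isSelfAdjoint_of_hasSum {V : Potential d} {P Q : SeqSpace d →L[ℂ] SeqSpace d}
    (hP : ∀ u, HasSum (fun x => ⟪conjugateDelta e x, u⟫_ℂ • (Complex.I * V x) • delta x) (P u))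
    (hQ : ∀ u, HasSum (fun x => ⟪delta x, u⟫_ℂ • (-(Complex.I * V x)) • conjugateDelta e x) (Q u)) :
    IsSelfAdjoint (P + Q) := by
  have hPQ : ∀ u w, ⟪P u, w⟫_ℂ = ⟪u, Q w⟫_ℂ := fun u w => by
    have h1 : HasSum (fun x => ⟪w, ⟪conjugateDelta e x, u⟫_ℂ • (Complex.I * V x) • delta x⟫_ℂ)
      ⟪w, P u⟫_ℂ := (innerSL ℂ w).hasSum (hP u)
    have h2 : HasSum
      (fun x => ⟪u, ⟪delta x, w⟫_ℂ • (-(Complex.I * V x)) • conjugateDelta e x⟫_ℂ)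
      ⟪u, Q w⟫_ℂ := (innerSL ℂ u).hasSum (hQ w)
    have h3 := Complex.hasSum_conj'.2 h1
    rw [inner_conj_symm] at h3
    refine h3.unique ?_
    convert h2 using 1
    funext x
    simp only [inner_smul_right, map_mul, inner_conj_symm, Complex.conj_I, Complex.conj_ofReal]
    ring
  rw [ContinuousLinearMap.isSelfAdjoint_iff_isSymmetric]
  intro u w
  have hQP : ⟪Q u, w⟫_ℂ = ⟪u, P w⟫_ℂ := by
    rw [← inner_conj_symm, ← hPQ, inner_conj_symm]
  simp only [ContinuousLinearMap.coe_coe, add_apply, inner_add_left, inner_add_right, hPQ, hQP]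
  ring

/-- The rank-one terms are indexed by two copies of the lattice, one for `P` and one for `Q`. In
each, exactly one of the two vectors is `A δₓ`, giving one factor `K`. The total weight is therefore
`2K ∑ |V(x)| (1 + |x|)⁴`, which explains the `2` in the smallness condition. -/
theorem exists_commutator_resolventEstimate (he : ContDiff ℝ 3 e) (hper : TorusPeriodic e)
    {C K c : ℝ} (hC : 0 ≤ C) (hK : 0 ≤ K) (hc : 0 < c) (hcCK : C * K ≤ c)
    (hfree : ∀ z : ℂ, z.im ≠ 0 → ∀ (φ ψ : (Fin d → ℝ) → ℂ) (M N : ℝ),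
      C1Bound φ M → C1Bound ψ N →
      ‖⟪fourierVec φ, resolvent (hopping (gradSq e)) z (fourierVec ψ)⟫_ℂ‖ ≤ C * (M * N))
    (hA : ∀ x : Lattice d, C1Bound (conjugateExpr e (character x)) (K * (1 + eucl x) ^ 2))
    {V : Potential d} (hV : 2 * ENNReal.ofReal c * Phi 2 3 V < 1) :
    ∃ B : SeqSpace d →L[ℂ] SeqSpace d,
      IsCommutator e (hamiltonian e V) B ∧ ResolventEstimate B := by
  have hV' : ENNReal.ofReal (2 * c) * Phi 2 3 V < 1 := by
    rwa [ENNReal.ofReal_mul two_pos.le, ENNReal.ofReal_ofNat]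
  obtain ⟨hsum, hsmall⟩ := summable_of_mul_Phi_lt_one (by positivity) (by norm_num) hV'
  have hδ := fun x : Lattice d => C1Bound.character x
  have hIV : ∀ x, ‖Complex.I * (V x : ℂ)‖ = |V x| := fun x => by
    rw [norm_mul, Complex.norm_I, one_mul, Complex.norm_real, Real.norm_eq_abs]
  have hnδ : ∀ x : Lattice d, ‖delta x‖ ≤ (1 + eucl x) ^ 2 := fun x => by
    rw [delta_eq_fourierVec]; exact norm_fourierVec_le (hδ x)
  have hnA : ∀ x : Lattice d, ‖conjugateDelta e x‖ ≤ K * (1 + eucl x) ^ 2 := fun x =>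
    norm_fourierVec_le (hA x)
  obtain ⟨P, hP⟩ := exists_hasSum_rankOne (a := fun x : Lattice d => (Complex.I * V x) • delta x)
    (b := conjugateDelta e) (by
      refine Summable.of_nonneg_of_le (fun x => by positivity) (fun x => ?_) (hsum.mul_left K)
      rw [norm_smul, hIV]
      calc |V x| * ‖delta x‖ * ‖conjugateDelta e x‖
          ≤ |V x| * (1 + eucl x) ^ 2 * (K * (1 + eucl x) ^ 2) := by
            gcongr
            exacts [hnδ x, hnA x]
        _ = _ := by ring)
  obtain ⟨Q, hQ⟩ := exists_hasSum_rankOne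
    (a := fun x : Lattice d => (-(Complex.I * V x)) • conjugateDelta e x) (b := delta) (by
      refine Summable.of_nonneg_of_le (fun x => by positivity) (fun x => ?_) (hsum.mul_left K)
      rw [norm_smul, norm_neg, hIV]
      calc |V x| * ‖conjugateDelta e x‖ * ‖delta x‖
          ≤ |V x| * (K * (1 + eucl x) ^ 2) * (1 + eucl x) ^ 2 := by
            gcongr
            exacts [hnA x, hnδ x]
        _ = _ := by ring)
  have hG : Continuous (gradSq e) := continuous_gradSq (he.of_le (by norm_num))
  refine ⟨hopping (gradSq e) + (P + Q), isCommutator_hamiltonian he hper hP hQ, ?_⟩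
  have hinl := hsum.hasSum.mul_left K
  set w : Lattice d → ℝ := fun x => |V x| * ((1 + eucl x) ^ 2 * (1 + eucl x) ^ 2)
  have htot : HasSum (fun j : Lattice d ⊕ Lattice d =>
      ‖Sum.elim (fun x => Complex.I * (V x : ℂ)) (fun x => -(Complex.I * (V x : ℂ))) j‖ *
        (Sum.elim (fun x => (1 + eucl x) ^ 2) (fun x => K * (1 + eucl x) ^ 2) j *
          Sum.elim (fun x => K * (1 + eucl x) ^ 2) (fun x => (1 + eucl x) ^ 2) j))
      (K * ∑' x, w x + K * ∑' x, w x) := by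
    refine HasSum.sum ?_ ?_
    · convert! hinl using 1
      funext x
      simp only [Function.comp, Sum.elim_inl, hIV]
      ring
    · convert! hinl using 1
      funext x
      simp only [Function.comp, Sum.elim_inr, norm_neg, hIV]
      ring
  have hw0 : 0 ≤ ∑' x, w x := tsum_nonneg fun x => by positivity
  refine resolventEstimate_of_hasSum hG hC hfree
    ((isSelfAdjoint_hopping hG).add (isSelfAdjoint_of_hasSum hP hQ))
    (v := Sum.elim (fun x => Complex.I * (V x : ℂ)) (fun x => -(Complex.I * (V x : ℂ))))
    (ξ := Sum.elim character fun x => conjugateExpr e (character x))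
    (η := Sum.elim (fun x => conjugateExpr e (character x)) character)
    (Sum.rec hδ hA) (Sum.rec hA hδ) htot.summable ?_ fun u => ?_
  · rw [htot.tsum_eq]
    nlinarith
  · rw [add_sub_cancel_left]
    refine HasSum.sum ?_ ?_
    · simpa only [Function.comp_def, Sum.elim_inl, ← delta_eq_fourierVec] using! hP u
    · simpa only [Function.comp_def, Sum.elim_inr, ← delta_eq_fourierVec] using! hQ u

end Commutator

end LatticeSchrodinger

theorem mainTheorem4 (d : ℕ) (hd : 3 ≤ d) (e : (Fin d → ℝ) → ℝ)
    (he_smooth : ContDiff ℝ 3 e) (he_per : TorusPeriodic e) (he_M : ConditionM e) :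
    ∃ c : ℝ, 0 < c ∧ ∀ V : Potential d,
      (ENNReal.ofReal c * Phi 2 2 V < 1 → ResolventEstimate (hamiltonian e V)) ∧
      (2 * ENNReal.ofReal c * Phi 2 3 V < 1 →
        ∃ B : SeqSpace d →L[ℂ] SeqSpace d,
          IsCommutator e (hamiltonian e V) B ∧
          (∀ B' : SeqSpace d →L[ℂ] SeqSpace d,
            IsCommutator e (hamiltonian e V) B' → B' = B) ∧
          ResolventEstimate B) := by
  obtain ⟨C₁, hC₁, h₁⟩ := he_M.1.exists_norm_inner_resolvent_le hd he_per
  obtain ⟨C₂, hC₂, h₂⟩ := he_M.2.exists_norm_inner_resolvent_le hd he_per.gradSq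
  obtain ⟨K, hK, hA⟩ := exists_C1Bound_conjugateExpr_character he_smooth he_per
  have hCK : 0 ≤ C₂ * K := mul_nonneg hC₂ hK
  -- One constant must dominate `C₁` for the Hamiltonian and `C₂ * K` for the commutator; the
  -- summand `1` guarantees strict positivity.
  have hc : 0 < C₁ + C₂ * K + 1 := by positivity
  refine ⟨C₁ + C₂ * K + 1, hc, fun V => ⟨fun hV => ?_, fun hV => ?_⟩⟩
  · refine resolventEstimate_hamiltonian he_smooth.continuous hc
      (fun z hz φ ψ M N hφ hψ => (h₁ z hz φ ψ M N hφ hψ).trans ?_) hV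
    exact mul_le_mul_of_nonneg_right (by linarith) (mul_nonneg hφ.nonneg hψ.nonneg)
  · obtain ⟨B, hB, hR⟩ := exists_commutator_resolventEstimate he_smooth he_per hC₂ hK hc
      (by linarith) h₂ hA hV
    exact ⟨B, hB, fun B' hB' => hB.unique hB', hR⟩
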